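/- Let $k$ be a commutative ring containing $\mathbb{Q}$, let $Q$ be a smooth $k$-algebra of relative dimension $n$, and let $f\in Q$. Write $\Omega^i=\bigwedge^i_Q\Omega^1_{Q/k}$. For $g\in Q$, a matrix factorization $\mathcal E=(E_1\xrightarrow{A}E_0\xrightarrow{B}E_1)$ of $g$ consists of finitely generated projective $Q$-modules $E_0,E_1$ and $Q$-linear maps $A,B$ with $AB=g\cdot 1_{E_0}$ and $BA=g\cdot 1_{E_1}$; put $E=E_0\oplus E_1$ and $d(e_0,e_1)=(Ae_1,Be_0)$. Let $[MF(Q,g)]$ be the homotopy category of matrix factorizations of $g$, triangulated by shift and mapping cones, and let $K_0([MF(Q,g)])$ be its Grothendieck group: the abelian group generated by isomorphism classes of objects, modulo $[X]+[Z]=[Y]$ for every distinguished triangle $X\to Y\to Z\to X[1]$. Put $K_f(Q)=\bigoplus_{i\ge 0}K_0([MF(Q,if)])$, a commutative ring with product $[\mathcal E]\cdot[\mathcal F]=[\mathcal E\otimes_{mf}\mathcal F]$, where $\mathcal E\otimes_{mf}\mathcal F$ has differential $d(x\otimes y)=dx\otimes y+(-1)^{|x|}x\otimes dy$, and unit the class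 of $Q$ in even degree, in the summand $i=0$. Let $(\Omega^\bullet,dg,n)$ be the complex $Q\xrightarrow{dg\wedge}\Omega^1\xrightarrow{dg\wedge}\cdots\xrightarrow{dg\wedge}\Omega^n$ and $H_0((\Omega^\bullet,dg,n)_{\mathbb{Z}/2})$ the even homology of its $\mathbb{Z}/2$-folding, that is, the kernel of $dg\wedge$ on even forms modulo $dg\wedge(\text{odd forms})$. The group $\bigoplus_{i\ge 0}H_0((\Omega^\bullet,i\,df,n)_{\mathbb{Z}/2})$ is a commutative ring under the wedge product. A connection on a $Q$-module $M$ is a $k$-linear map $\nabla:M\to\Omega^1\otimes_Q M$ with $\nabla(qm)=dq\otimes m+q\nabla(m)$. Given connections $\nabla_0,\nabla_1$ on $E_0,E_1$, let $\nabla=\nabla_0\oplus\nabla_1$, let $At=\nabla\circ d-(1\otimes d)\circ\nabla:E\to\Omega^1\otimes_Q E$, a $Q$-linear map, and let $At^i:E\to\Omega^i\otimes_Q E$ be its $i$-fold composite followed by the wedge product of forms (with $At^0=\mathrm{id}$). For $T:E\to\Omega^i\otimes_Q E$ let $\mathrm{str}(T)=\mathrm{tr}(T_{00})-\mathrm{tr}(T_{11})\in\Omega^i$,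 where $T_{jj}$ is the component $E_j\to\Omega^i\otimes_Q E_j$. Then for every matrix factorization over $Q$ both of its modules admit connections. Moreover, there is a unique ring homomorphism $$ch:K_f(Q)\longrightarrow\bigoplus_{i\ge 0}H_0((\Omega^\bullet,i\,df,n)_{\mathbb{Z}/2})$$ such that for every $i\ge 0$, every $\mathcal E\in MF(Q,if)$ and every choice of connections, the form $\sum_{j=0}^n\frac{1}{j!}\mathrm{str}(At_{\mathcal E}^j)$ is an even cycle and $ch([\mathcal E])$ is its homology class, in the $i$-th summand. In particular $ch([\mathcal E\otimes_{mf}\mathcal F])=ch([\mathcal E])\,ch([\mathcal F])$ for all $\mathcal E\in MF(Q,if)$ and $\mathcal F\in MF(Q,jf)$. -/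

import Mathlib

open scoped TensorProduct DirectSum

universe u v

set_option linter.unusedSimpArgs false
set_option linter.unnecessarySeqFocus false

/-- A matrix factorization of `f ∈ Q`: finitely generated projective `Q`-modules `M0` (even part)
and `M1` (odd part) with maps `d0 : M0 → M1`, `d1 : M1 → M0` both of whose composites are
multiplication by `f`. -/
structure MatrixFactorization (Q : Type u) [CommRing Q] (f : Q) where
  M0 : Type u
  M1 : Type u
  [addCommGroup0 : AddCommGroup M0]
  [addCommGroup1 : AddCommGroup M1]
  [module0 : Module Q M0]
  [module1 : Module Q M1]
  [finite0 : Module.Finite Q M0]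
  [finite1 : Module.Finite Q M1]
  [projective0 : Module.Projective Q M0]
  [projective1 : Module.Projective Q M1]
  d0 : M0 →ₗ[Q] M1
  d1 : M1 →ₗ[Q] M0
  d1_comp_d0 : d1 ∘ₗ d0 = f • LinearMap.id
  d0_comp_d1 : d0 ∘ₗ d1 = f • LinearMap.id

namespace MatrixFactorization

attribute [instance] addCommGroup0 addCommGroup1 module0 module1 finite0 finite1
  projective0 projective1

variable {Q : Type u} [CommRing Q] {f g h : Q}

@[simp] theorem d1_d0 (E : MatrixFactorization Q f) (x : E.M0) : E.d1 (E.d0 x) = f • x :=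
  LinearMap.congr_fun E.d1_comp_d0 x

@[simp] theorem d0_d1 (E : MatrixFactorization Q f) (x : E.M1) : E.d0 (E.d1 x) = f • x :=
  LinearMap.congr_fun E.d0_comp_d1 x

/-- Strict morphisms: pairs of linear maps commuting with the differentials. -/
structure Hom (E F : MatrixFactorization Q f) where
  φ0 : E.M0 →ₗ[Q] F.M0
  φ1 : E.M1 →ₗ[Q] F.M1
  comm0 : F.d0 ∘ₗ φ0 = φ1 ∘ₗ E.d0
  comm1 : F.d1 ∘ₗ φ1 = φ0 ∘ₗ E.d1

theorem Hom.d0_apply {E F : MatrixFactorization Q f} (α : Hom E F) (x : E.M0) :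
    F.d0 (α.φ0 x) = α.φ1 (E.d0 x) := LinearMap.congr_fun α.comm0 x

theorem Hom.d1_apply {E F : MatrixFactorization Q f} (α : Hom E F) (x : E.M1) :
    F.d1 (α.φ1 x) = α.φ0 (E.d1 x) := LinearMap.congr_fun α.comm1 x

/-- The identity morphism. -/
def Hom.id (E : MatrixFactorization Q f) : Hom E E where
  φ0 := LinearMap.id
  φ1 := LinearMap.id
  comm0 := rfl
  comm1 := rfl

/-- Composition of strict morphisms, `β` after `α`. -/
def Hom.comp {E F G : MatrixFactorization Q f} (β : Hom F G) (α : Hom E F) : Hom E G where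
  φ0 := β.φ0 ∘ₗ α.φ0
  φ1 := β.φ1 ∘ₗ α.φ1
  comm0 := by ext x; simp [Hom.d0_apply]
  comm1 := by ext x; simp [Hom.d1_apply]

/-- Two strict morphisms are homotopic if `d h + h d = α - β` for some odd linear map `h`. -/
def Homotopic {E F : MatrixFactorization Q f} (α β : Hom E F) : Prop :=
  ∃ (h0 : E.M0 →ₗ[Q] F.M1) (h1 : E.M1 →ₗ[Q] F.M0),
    F.d1 ∘ₗ h0 + h1 ∘ₗ E.d0 = α.φ0 - β.φ0 ∧ F.d0 ∘ₗ h1 + h0 ∘ₗ E.d1 = α.φ1 - β.φ1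

theorem Homotopic.refl {E F : MatrixFactorization Q f} (α : Hom E F) : Homotopic α α :=
  ⟨0, 0, by simp, by simp⟩

/-- A strict morphism that becomes an isomorphism in the homotopy category. -/
def IsHomotopyEquiv {E F : MatrixFactorization Q f} (α : Hom E F) : Prop :=
  ∃ β : Hom F E, Homotopic (α.comp β) (Hom.id F) ∧ Homotopic (β.comp α) (Hom.id E)

/-- `E` and `F` are isomorphic objects of the homotopy category. -/
def HomotopyEquivalent (E F : MatrixFactorization Q f) : Prop :=
  ∃ α : Hom E F, IsHomotopyEquiv α

theorem isHomotopyEquiv_id (E : MatrixFactorization Q f) : IsHomotopyEquiv (Hom.id E) :=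
  ⟨Hom.id E, Homotopic.refl _, Homotopic.refl _⟩

/-- The shift `E[1]`: the two parts are exchanged and the differentials change sign. -/
abbrev shift (E : MatrixFactorization Q f) : MatrixFactorization Q f where
  M0 := E.M1
  M1 := E.M0
  d0 := -E.d1
  d1 := -E.d0
  d1_comp_d0 := by ext x; simp
  d0_comp_d1 := by ext x; simp

/-- The shift of a strict morphism. -/
def Hom.shift {E F : MatrixFactorization Q f} (α : Hom E F) : Hom E.shift F.shift where
  φ0 := α.φ1
  φ1 := α.φ0
  comm0 := by ext x; simp [MatrixFactorization.shift, Hom.d1_apply]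
  comm1 := by ext x; simp [MatrixFactorization.shift, Hom.d0_apply]

/-- The cone of `α : M → N`, with even part `N0 ⊕ M1` and odd part `N1 ⊕ M0`. -/
abbrev cone {M N : MatrixFactorization Q f} (α : Hom M N) : MatrixFactorization Q f where
  M0 := N.M0 × M.M1
  M1 := N.M1 × M.M0
  d0 := LinearMap.prod (N.d0 ∘ₗ LinearMap.fst Q N.M0 M.M1 + α.φ1 ∘ₗ LinearMap.snd Q N.M0 M.M1)
    (-(M.d1 ∘ₗ LinearMap.snd Q N.M0 M.M1))
  d1 := LinearMap.prod (N.d1 ∘ₗ LinearMap.fst Q N.M1 M.M0 + α.φ0 ∘ₗ LinearMap.snd Q N.M1 M.M0)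
    (-(M.d0 ∘ₗ LinearMap.snd Q N.M1 M.M0))
  d1_comp_d0 := by ext x <;> simp [Hom.d1_apply]
  d0_comp_d1 := by ext x <;> simp [Hom.d0_apply]

/-- The canonical map `N → cone α`. -/
def coneIncl {M N : MatrixFactorization Q f} (α : Hom M N) : Hom N (cone α) where
  φ0 := LinearMap.inl Q N.M0 M.M1
  φ1 := LinearMap.inl Q N.M1 M.M0
  comm0 := by ext x <;> simp [cone]
  comm1 := by ext x <;> simp [cone]

/-- The canonical map `cone α → M[1]`. -/
def coneProj {M N : MatrixFactorization Q f} (α : Hom M N) : Hom (cone α) M.shift where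
  φ0 := LinearMap.snd Q N.M0 M.M1
  φ1 := LinearMap.snd Q N.M1 M.M0
  comm0 := by ext x <;> simp [cone, shift]
  comm1 := by ext x <;> simp [cone, shift]

/-- Distinguished triangles `X → Y → Z → X[1]` of the homotopy category: those isomorphic there to
`M → N → cone α → M[1]` for some strict morphism `α : M → N`. -/
def IsDistinguished {X Y Z : MatrixFactorization Q f} (u : Hom X Y) (v : Hom Y Z)
    (w : Hom Z X.shift) : Prop :=
  ∃ (M N : MatrixFactorization Q f) (α : Hom M N) (a : Hom X M) (b : Hom Y N)
    (c : Hom Z (cone α)), IsHomotopyEquiv a ∧ IsHomotopyEquiv b ∧ IsHomotopyEquiv c ∧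
    Homotopic (b.comp u) (α.comp a) ∧ Homotopic (c.comp v) ((coneIncl α).comp b) ∧
    Homotopic (a.shift.comp w) ((coneProj α).comp c)

theorem isDistinguished_cone {M N : MatrixFactorization Q f} (α : Hom M N) :
    IsDistinguished α (coneIncl α) (coneProj α) :=
  ⟨M, N, α, Hom.id M, Hom.id N, Hom.id _, isHomotopyEquiv_id M, isHomotopyEquiv_id N,
    isHomotopyEquiv_id _, Homotopic.refl _, Homotopic.refl _, Homotopic.refl _⟩

/-- The tensor product of `E ∈ MF(Q, f)` and `F ∈ MF(Q, g)`, a matrix factorization of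
`h = f + g`, with differential `d(m ⊗ n) = d m ⊗ n + (-1)^|m| m ⊗ d n`. -/
noncomputable abbrev tensor (E : MatrixFactorization Q f) (F : MatrixFactorization Q g)
    (e : f + g = h) : MatrixFactorization Q h where
  M0 := (E.M0 ⊗[Q] F.M0) × (E.M1 ⊗[Q] F.M1)
  M1 := (E.M1 ⊗[Q] F.M0) × (E.M0 ⊗[Q] F.M1)
  d0 := LinearMap.coprod
    (LinearMap.prod (E.d0.rTensor F.M0) (F.d0.lTensor E.M0))
    (LinearMap.prod (-F.d1.lTensor E.M1) (E.d1.rTensor F.M1))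
  d1 := LinearMap.coprod
    (LinearMap.prod (E.d1.rTensor F.M0) (-F.d0.lTensor E.M1))
    (LinearMap.prod (F.d1.lTensor E.M0) (E.d0.rTensor F.M1))
  d1_comp_d0 := by
    subst e
    ext <;> simp [add_smul, TensorProduct.smul_tmul'] <;> abel
  d0_comp_d1 := by
    subst e
    ext <;> simp [add_smul, TensorProduct.smul_tmul'] <;> abel

/-- The unit for the tensor product: `Q` in even degree, a matrix factorization of `0`. -/
abbrev unit (Q : Type u) [CommRing Q] {f : Q} (e : f = 0) : MatrixFactorization Q f where
  M0 := Q
  M1 := PUnit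
  d0 := 0
  d1 := 0
  d1_comp_d0 := by subst e; simp
  d0_comp_d1 := by subst e; simp

/-- Transport along an equality `f = g`. -/
abbrev cast (e : f = g) (E : MatrixFactorization Q f) : MatrixFactorization Q g where
  M0 := E.M0
  M1 := E.M1
  d0 := E.d0
  d1 := E.d1
  d1_comp_d0 := e ▸ E.d1_comp_d0
  d0_comp_d1 := e ▸ E.d0_comp_d1

theorem homotopyEquivalent_of_iso {E F : MatrixFactorization Q f} (e0 : E.M0 ≃ₗ[Q] F.M0)
    (e1 : E.M1 ≃ₗ[Q] F.M1) (c0 : F.d0 ∘ₗ e0.toLinearMap = e1.toLinearMap ∘ₗ E.d0)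
    (c1 : F.d1 ∘ₗ e1.toLinearMap = e0.toLinearMap ∘ₗ E.d1) : HomotopyEquivalent E F := by
  refine ⟨⟨e0, e1, c0, c1⟩, ⟨e0.symm, e1.symm, ?_, ?_⟩, ?_, ?_⟩
  · ext x
    apply e1.injective
    have := LinearMap.congr_fun c0 (e0.symm x)
    simp at this
    simp [this]
  · ext x
    apply e0.injective
    have := LinearMap.congr_fun c1 (e1.symm x)
    simp at this
    simp [this]
  · refine ⟨0, 0, ?_, ?_⟩ <;> ext <;> simp [Hom.comp, Hom.id]
  · refine ⟨0, 0, ?_, ?_⟩ <;> ext <;> simp [Hom.comp, Hom.id]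

/-- Functoriality of the tensor product in the first variable. -/
noncomputable def Hom.rTensor {E E' : MatrixFactorization Q f} (α : Hom E E')
    (F : MatrixFactorization Q g) (e : f + g = h) : Hom (E.tensor F e) (E'.tensor F e) where
  φ0 := LinearMap.prodMap (α.φ0.rTensor F.M0) (α.φ1.rTensor F.M1)
  φ1 := LinearMap.prodMap (α.φ1.rTensor F.M0) (α.φ0.rTensor F.M1)
  comm0 := by ext <;> simp [tensor, Hom.d0_apply, Hom.d1_apply]
  comm1 := by ext <;> simp [tensor, Hom.d0_apply, Hom.d1_apply]

theorem Homotopic.rTensor {E E' : MatrixFactorization Q f} {α β : Hom E E'} (H : Homotopic α β)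
    (F : MatrixFactorization Q g) (e : f + g = h) : Homotopic (α.rTensor F e) (β.rTensor F e) := by
  obtain ⟨h0, h1, e0, e1⟩ := H
  refine ⟨LinearMap.prodMap (h0.rTensor F.M0) (h1.rTensor F.M1),
    LinearMap.prodMap (h1.rTensor F.M0) (h0.rTensor F.M1), ?_, ?_⟩
  · ext x y
    · have := LinearMap.congr_fun e0 x
      simp at this
      simp [tensor, Hom.rTensor, ← TensorProduct.add_tmul, ← TensorProduct.sub_tmul, this]
    · simp [tensor, Hom.rTensor]
    · simp [tensor, Hom.rTensor]
    · have := LinearMap.congr_fun e1 x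
      simp at this
      simp [tensor, Hom.rTensor, ← TensorProduct.add_tmul, ← TensorProduct.sub_tmul, this]
  · ext x y
    · have := LinearMap.congr_fun e1 x
      simp at this
      simp [tensor, Hom.rTensor, ← TensorProduct.add_tmul, ← TensorProduct.sub_tmul, this]
    · simp [tensor, Hom.rTensor]
    · simp [tensor, Hom.rTensor]
    · have := LinearMap.congr_fun e0 x
      simp at this
      simp [tensor, Hom.rTensor, ← TensorProduct.add_tmul, ← TensorProduct.sub_tmul, this]

theorem HomotopyEquivalent.rTensor {E E' : MatrixFactorization Q f} (H : HomotopyEquivalent E E')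
    (F : MatrixFactorization Q g) (e : f + g = h) :
    HomotopyEquivalent (E.tensor F e) (E'.tensor F e) := by
  obtain ⟨α, β, h1, h2⟩ := H
  refine ⟨α.rTensor F e, β.rTensor F e, ?_, ?_⟩
  · convert h1.rTensor F e using 1
    · simp [Hom.comp, Hom.rTensor, LinearMap.prodMap_comp, LinearMap.rTensor_comp]
    · simp [Hom.id, Hom.rTensor]
  · convert h2.rTensor F e using 1
    · simp [Hom.comp, Hom.rTensor, LinearMap.prodMap_comp, LinearMap.rTensor_comp]
    · simp [Hom.id, Hom.rTensor]

theorem tensor_comm_equiv (E : MatrixFactorization Q f) (F : MatrixFactorization Q g)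
    (e : f + g = h) (e' : g + f = h) :
    HomotopyEquivalent (E.tensor F e) (F.tensor E e') := by
  refine homotopyEquivalent_of_iso
    (LinearEquiv.prodCongr (TensorProduct.comm Q E.M0 F.M0)
      ((TensorProduct.comm Q E.M1 F.M1).trans (LinearEquiv.neg Q)))
    ((LinearEquiv.prodCongr (TensorProduct.comm Q E.M1 F.M0)
      (TensorProduct.comm Q E.M0 F.M1)).trans (LinearEquiv.prodComm Q _ _)) ?_ ?_ <;>
  ext <;> simp [tensor]

set_option maxHeartbeats 2000000 in
theorem tensor_cone_equiv {M N : MatrixFactorization Q f} (α : Hom M N)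
    (F : MatrixFactorization Q g) (e : f + g = h) :
    HomotopyEquivalent ((cone α).tensor F e) (cone (α.rTensor F e)) := by
  refine homotopyEquivalent_of_iso
    (((TensorProduct.prodLeft Q Q N.M0 M.M1 F.M0).prodCongr
      (TensorProduct.prodLeft Q Q N.M1 M.M0 F.M1)).trans (LinearEquiv.prodProdProdComm Q _ _ _ _))
    (((TensorProduct.prodLeft Q Q N.M1 M.M0 F.M0).prodCongr
      (TensorProduct.prodLeft Q Q N.M0 M.M1 F.M1)).trans (LinearEquiv.prodProdProdComm Q _ _ _ _))
    ?_ ?_ <;>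
  ext <;> simp only [Hom.rTensor, TensorProduct.AlgebraTensorModule.curry_apply, LinearMap.restrictScalars_self,
    TensorProduct.curry_apply, LinearMap.coe_comp, LinearMap.coe_inl, LinearMap.coe_inr,
    LinearMap.coe_fst, LinearMap.coe_snd, Function.comp_apply, LinearEquiv.coe_coe,
    LinearEquiv.trans_apply, LinearEquiv.prodCongr_apply, LinearEquiv.prodComm_apply,
    LinearEquiv.prodProdProdComm_apply, LinearEquiv.apply_symm_apply, Prod.swap_prod_mk,
    Prod.fst_zero, Prod.snd_zero, Prod.mk_add_mk, Prod.neg_mk, Prod.mk_zero_zero,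
    TensorProduct.prodLeft_tmul, TensorProduct.prodRight_tmul, TensorProduct.prodRight_symm_tmul,
    TensorProduct.assoc_tmul, TensorProduct.zero_tmul, TensorProduct.tmul_zero,
    TensorProduct.neg_tmul, TensorProduct.tmul_neg, LinearMap.map_zero, LinearEquiv.map_zero,
    LinearMap.map_neg, map_neg, LinearMap.coprod_apply, LinearMap.prod_apply,
    LinearMap.prodMap_apply, LinearMap.add_apply, Function.prod_apply, LinearMap.rTensor_tmul,
    LinearMap.lTensor_tmul, LinearMap.neg_apply, Pi.neg_apply, neg_zero, neg_neg, add_zero,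
    zero_add]

theorem one_tensor_equiv (F : MatrixFactorization Q g) (e : f = 0) (e' : f + g = h) (e'' : g = h) :
    HomotopyEquivalent ((unit Q e).tensor F e') (F.cast e'') := by
  have p (M : Type u) [AddCommGroup M] [Module Q M] : Subsingleton (PUnit.{u + 1} ⊗[Q] M) :=
    ⟨fun x y => by
      have key : ∀ z : PUnit.{u + 1} ⊗[Q] M, z = 0 := fun z => by
        induction z with
        | zero => rfl
        | tmul a m => rw [Subsingleton.elim a 0, TensorProduct.zero_tmul]
        | add a b ha hb => rw [ha, hb, add_zero]
      rw [key x, key y]⟩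
  refine homotopyEquivalent_of_iso
    ((LinearEquiv.prodUnique (M := Q ⊗[Q] F.M0)).trans (TensorProduct.lid Q F.M0))
    ((LinearEquiv.uniqueProd (M := Q ⊗[Q] F.M1)).trans (TensorProduct.lid Q F.M1))
    ?_ ?_ <;> ext <;> simp

set_option maxHeartbeats 2000000 in
theorem tensor_assoc_equiv {a b c : Q} (E : MatrixFactorization Q f) (F : MatrixFactorization Q g)
    (G : MatrixFactorization Q h) (e1 : f + g = a) (e2 : a + h = c) (e3 : g + h = b)
    (e4 : f + b = c) :
    HomotopyEquivalent ((E.tensor F e1).tensor G e2) (E.tensor (F.tensor G e3) e4) := by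
  have r0 (A B C : Type u) [AddCommGroup A] [AddCommGroup B] [AddCommGroup C] [Module Q A]
      [Module Q B] [Module Q C] : (TensorProduct.prodRight Q Q A B C).symm (0, 0) = 0 :=
    map_zero (TensorProduct.prodRight Q Q A B C).symm
  have r1 (A B C : Type u) [AddCommGroup A] [AddCommGroup B] [AddCommGroup C] [Module Q A]
      [Module Q B] [Module Q C] (x : A) (y : B) :
      (TensorProduct.prodRight Q Q A B C).symm (x ⊗ₜ[Q] y, 0) = x ⊗ₜ[Q] (y, 0) := by
    rw [LinearEquiv.symm_apply_eq]; simp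
  have r2 (A B C : Type u) [AddCommGroup A] [AddCommGroup B] [AddCommGroup C] [Module Q A]
      [Module Q B] [Module Q C] (x : A) (y : C) :
      (TensorProduct.prodRight Q Q A B C).symm (0, x ⊗ₜ[Q] y) = x ⊗ₜ[Q] (0, y) := by
    rw [LinearEquiv.symm_apply_eq]; simp
  refine homotopyEquivalent_of_iso
    (((((TensorProduct.prodLeft Q Q (E.M0 ⊗[Q] F.M0) (E.M1 ⊗[Q] F.M1) G.M0).trans
        ((TensorProduct.assoc Q E.M0 F.M0 G.M0).prodCongr
          (TensorProduct.assoc Q E.M1 F.M1 G.M0))).prodCongr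
      (((TensorProduct.prodLeft Q Q (E.M1 ⊗[Q] F.M0) (E.M0 ⊗[Q] F.M1) G.M1).trans
        ((TensorProduct.assoc Q E.M1 F.M0 G.M1).prodCongr
          (TensorProduct.assoc Q E.M0 F.M1 G.M1))).trans (LinearEquiv.prodComm Q _ _))).trans
      (LinearEquiv.prodProdProdComm Q _ _ _ _)).trans
      ((TensorProduct.prodRight Q Q E.M0 (F.M0 ⊗[Q] G.M0) (F.M1 ⊗[Q] G.M1)).symm.prodCongr
        (TensorProduct.prodRight Q Q E.M1 (F.M1 ⊗[Q] G.M0) (F.M0 ⊗[Q] G.M1)).symm))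
    (((((TensorProduct.prodLeft Q Q (E.M1 ⊗[Q] F.M0) (E.M0 ⊗[Q] F.M1) G.M0).trans
        ((TensorProduct.assoc Q E.M1 F.M0 G.M0).prodCongr
          (TensorProduct.assoc Q E.M0 F.M1 G.M0))).prodCongr
      (((TensorProduct.prodLeft Q Q (E.M0 ⊗[Q] F.M0) (E.M1 ⊗[Q] F.M1) G.M1).trans
        ((TensorProduct.assoc Q E.M0 F.M0 G.M1).prodCongr
          (TensorProduct.assoc Q E.M1 F.M1 G.M1))).trans (LinearEquiv.prodComm Q _ _))).trans
      (LinearEquiv.prodProdProdComm Q _ _ _ _)).trans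
      ((TensorProduct.prodRight Q Q E.M1 (F.M0 ⊗[Q] G.M0) (F.M1 ⊗[Q] G.M1)).symm.prodCongr
        (TensorProduct.prodRight Q Q E.M0 (F.M1 ⊗[Q] G.M0) (F.M0 ⊗[Q] G.M1)).symm))
    ?_ ?_ <;>
  ext <;> apply (TensorProduct.prodRight Q Q _ _ _).injective <;>
  simp only [r0, r1, r2, TensorProduct.AlgebraTensorModule.curry_apply, LinearMap.restrictScalars_self,
    TensorProduct.curry_apply, LinearMap.coe_comp, LinearMap.coe_inl, LinearMap.coe_inr,
    LinearMap.coe_fst, LinearMap.coe_snd, Function.comp_apply, LinearEquiv.coe_coe,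
    LinearEquiv.trans_apply, LinearEquiv.prodCongr_apply, LinearEquiv.prodComm_apply,
    LinearEquiv.prodProdProdComm_apply, LinearEquiv.apply_symm_apply, Prod.swap_prod_mk,
    Prod.fst_zero, Prod.snd_zero, Prod.mk_add_mk, Prod.neg_mk, Prod.mk_zero_zero,
    TensorProduct.prodLeft_tmul, TensorProduct.prodRight_tmul, TensorProduct.prodRight_symm_tmul,
    TensorProduct.assoc_tmul, TensorProduct.zero_tmul, TensorProduct.tmul_zero,
    TensorProduct.neg_tmul, TensorProduct.tmul_neg, LinearMap.map_zero, LinearEquiv.map_zero,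
    LinearMap.map_neg, map_neg, LinearMap.coprod_apply, LinearMap.prod_apply,
    LinearMap.prodMap_apply, LinearMap.add_apply, Function.prod_apply, LinearMap.rTensor_tmul,
    LinearMap.lTensor_tmul, LinearMap.neg_apply, Pi.neg_apply, neg_zero, neg_neg, add_zero,
    zero_add]

end MatrixFactorization

namespace MatrixFactorization

variable {Q : Type u} [CommRing Q] {f g h : Q}

/-- The relations defining `K_0` of the homotopy category: isomorphic objects are identified and
`[X] + [Z] = [Y]` for every distinguished triangle `X → Y → Z → X[1]`. -/
def K0Rel (f : Q) : Set (FreeAbelianGroup (MatrixFactorization Q f)) :=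
  {x | ∃ X Y : MatrixFactorization Q f, HomotopyEquivalent X Y ∧
    x = FreeAbelianGroup.of X - FreeAbelianGroup.of Y} ∪
  {x | ∃ (X Y Z : MatrixFactorization Q f) (u : Hom X Y) (v : Hom Y Z) (w : Hom Z X.shift),
    IsDistinguished u v w ∧
    x = FreeAbelianGroup.of X + FreeAbelianGroup.of Z - FreeAbelianGroup.of Y}

/-- The Grothendieck group of the triangulated category `[MF(Q, f)]`. -/
def K0 (f : Q) : Type (u + 1) :=
  FreeAbelianGroup (MatrixFactorization Q f) ⧸ AddSubgroup.closure (K0Rel f)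

instance (f : Q) : AddCommGroup (K0 f) :=
  inferInstanceAs (AddCommGroup (_ ⧸ AddSubgroup.closure (K0Rel f)))

/-- The quotient map onto `K0`. -/
def K0.proj (f : Q) : FreeAbelianGroup (MatrixFactorization Q f) →+ K0 f :=
  QuotientAddGroup.mk' (AddSubgroup.closure (K0Rel f))

theorem K0.proj_eq_zero {x : FreeAbelianGroup (MatrixFactorization Q f)} (hx : x ∈ K0Rel f) :
    K0.proj f x = 0 :=
  (QuotientAddGroup.eq_zero_iff _).2 (AddSubgroup.subset_closure hx)

/-- The class `[E]`. -/
def K0.of (E : MatrixFactorization Q f) : K0 f := K0.proj f (FreeAbelianGroup.of E)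

theorem K0.of_eq {X Y : MatrixFactorization Q f} (H : HomotopyEquivalent X Y) :
    K0.of X = K0.of Y := by
  rw [← sub_eq_zero, K0.of, K0.of, ← map_sub]
  exact K0.proj_eq_zero (.inl ⟨X, Y, H, rfl⟩)

theorem K0.of_cone {M N : MatrixFactorization Q f} (α : Hom M N) :
    K0.of M + K0.of (cone α) = K0.of N := by
  rw [← sub_eq_zero, K0.of, K0.of, K0.of, ← map_add, ← map_sub]
  exact K0.proj_eq_zero (.inr ⟨M, N, cone α, _, _, _, isDistinguished_cone α, rfl⟩)

theorem K0.induction {p : K0 f → Prop} (x : K0 f) (of : ∀ E, p (K0.of E))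
    (neg : ∀ x, p x → p (-x)) (add : ∀ x y, p x → p y → p (x + y)) (zero : p 0) : p x := by
  obtain ⟨x, rfl⟩ := QuotientAddGroup.mk'_surjective _ x
  induction x using FreeAbelianGroup.induction_on with
  | zero => exact zero
  | of E => exact of E
  | neg E ih => exact neg _ ih
  | add x y hx hy => exact add _ _ hx hy

/-- Additive maps out of `K0`. -/
def K0.lift {A : Type*} [AddCommGroup A] (φ : MatrixFactorization Q f → A)
    (h1 : ∀ X Y, HomotopyEquivalent X Y → φ X = φ Y)
    (h2 : ∀ (M N) (α : Hom M N), φ M + φ (cone α) = φ N) : K0 f →+ A :=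
  QuotientAddGroup.lift (AddSubgroup.closure (K0Rel f)) (FreeAbelianGroup.lift φ) <| by
    rw [AddSubgroup.closure_le]
    rintro x (⟨X, Y, H, rfl⟩ | ⟨X, Y, Z, u, v, w, ⟨M, N, α, a, b, c, ha, hb, hc, -⟩, rfl⟩)
    · simp [h1 X Y H]
    · simp [h1 X M ⟨a, ha⟩, h1 Y N ⟨b, hb⟩, h1 Z _ ⟨c, hc⟩, h2]

@[simp] theorem K0.lift_of {A : Type*} [AddCommGroup A] (φ : MatrixFactorization Q f → A) (h1 h2)
    (E : MatrixFactorization Q f) : K0.lift φ h1 h2 (K0.of E) = φ E :=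
  FreeAbelianGroup.lift_apply_of φ E

/-- Multiplication by the class of `F` on the right. -/
noncomputable def K0.mulRight (F : MatrixFactorization Q g) (e : f + g = h) : K0 f →+ K0 h :=
  K0.lift (fun E => K0.of (E.tensor F e)) (fun _ _ H => K0.of_eq (H.rTensor F e))
    (fun M N α => by rw [K0.of_eq (tensor_cone_equiv α F e), K0.of_cone])

/-- The product `[E] · [F] = [E ⊗ F]`. -/
noncomputable def K0.mul (e : f + g = h) : K0 f →+ K0 g →+ K0 h :=
  (K0.lift (fun F => K0.mulRight F e)
    (fun X Y H => by
      ext x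
      induction x using K0.induction with
      | zero => simp
      | neg x hx => simp [hx]
      | add x y hx hy => simp [hx, hy]
      | of E =>
        have e' : g + f = h := by rw [add_comm, e]
        simp only [mulRight, lift_of]
        rw [K0.of_eq (tensor_comm_equiv E X e e'), K0.of_eq (tensor_comm_equiv E Y e e')]
        exact K0.of_eq (H.rTensor E e'))
    (fun M N α => by
      ext x
      induction x using K0.induction with
      | zero => simp
      | neg x hx => simp only [map_neg, hx]
      | add x y hx hy => simp only [map_add, hx, hy]
      | of E =>
        have e' : g + f = h := by rw [add_comm, e]
        simp only [mulRight, lift_of, AddMonoidHom.add_apply]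
        rw [K0.of_eq (tensor_comm_equiv E M e e'), K0.of_eq (tensor_comm_equiv E N e e'),
          K0.of_eq (tensor_comm_equiv E (cone α) e e'), K0.of_eq (tensor_cone_equiv α E e'),
          K0.of_cone])).flip

@[simp] theorem K0.mul_of (e : f + g = h) (E : MatrixFactorization Q f)
    (F : MatrixFactorization Q g) :
    K0.mul e (K0.of E) (K0.of F) = K0.of (E.tensor F e) := by
  simp [K0.mul, K0.mulRight]

/-- The group `K_0([MF(Q, i f)])`. -/
def GradedK0 (f : Q) (i : ℕ) : Type (u + 1) := K0 (i • f)

instance (f : Q) (i : ℕ) : AddCommGroup (GradedK0 f i) := inferInstanceAs (AddCommGroup (K0 _))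

/-- Transport along an equality `f = g`. -/
def K0.cast (e : f = g) : K0 f →+ K0 g := e ▸ AddMonoidHom.id (K0 f)

@[simp] theorem K0.cast_of (e : f = g) (E : MatrixFactorization Q f) :
    K0.cast e (K0.of E) = K0.of (E.cast e) := by
  subst e; rfl

theorem gradedK0_ext {i j : ℕ} (hij : i = j) (x : K0 (i • f)) (y : K0 (j • f))
    (H : ∀ e : i • f = j • f, K0.cast e x = y) :
    GradedMonoid.mk (A := GradedK0 f) i x = GradedMonoid.mk (A := GradedK0 f) j y := by
  subst hij
  rw [← H rfl]
  rfl

theorem K0.mul_comm' (e : f + g = h) (e' : g + f = h) (x : K0 f) (y : K0 g) :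
    K0.mul e x y = K0.mul e' y x := by
  induction x using K0.induction with
  | zero => simp
  | neg x hx => simp [hx]
  | add x y hx hy => simp [hx, hy]
  | of E =>
    induction y using K0.induction with
    | zero => simp
    | neg x hx => simp [hx]
    | add x y hx hy => simp [hx, hy]
    | of F => simpa using K0.of_eq (tensor_comm_equiv E F e e')

theorem K0.mul_assoc' {a b c : Q} (e1 : f + g = a) (e2 : a + h = c) (e3 : g + h = b)
    (e4 : f + b = c) (x : K0 f) (y : K0 g) (z : K0 h) :
    K0.mul e2 (K0.mul e1 x y) z = K0.mul e4 x (K0.mul e3 y z) := by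
  induction x using K0.induction with
  | zero => simp
  | neg x hx => simp [hx]
  | add x y hx hy => simp [hx, hy]
  | of E =>
    induction y using K0.induction with
    | zero => simp
    | neg x hx => simp [hx]
    | add x y hx hy => simp [hx, hy]
    | of F =>
      induction z using K0.induction with
      | zero => simp
      | neg x hx => simp only [map_neg, hx]
      | add x y hx hy => simp only [map_add, hx, hy]
      | of G => simpa using K0.of_eq (tensor_assoc_equiv E F G e1 e2 e3 e4)

theorem K0.one_mul' (e : f = 0) (e' : f + g = h) (e'' : g = h) (x : K0 g) :
    K0.mul e' (K0.of (unit Q e)) x = K0.cast e'' x := by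
  induction x using K0.induction with
  | zero => simp
  | neg x hx => simp only [map_neg, hx]
  | add x y hx hy => simp only [map_add, hx, hy]
  | of F => simpa using K0.of_eq (one_tensor_equiv F e e' e'')

theorem K0.cast_mul {a b : Q} (e : f + g = a) (e' : a = b) (x : K0 f) (y : K0 g) :
    K0.cast e' (K0.mul e x y) = K0.mul (e.trans e') x y := by
  subst e'; rfl

noncomputable instance (f : Q) : GradedMonoid.GMul (GradedK0 f) where
  mul {i j} x y := K0.mul (add_smul i j f).symm x y

noncomputable instance (f : Q) : GradedMonoid.GOne (GradedK0 f) where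
  one := K0.of (unit Q (zero_smul ℕ f))

theorem gradedK0_one_mul (a : GradedMonoid (GradedK0 f)) : 1 * a = a := by
  obtain ⟨i, a⟩ := a
  refine gradedK0_ext (zero_add i)
    (K0.mul (add_smul 0 i f).symm (K0.of (unit Q (zero_smul ℕ f))) a) a fun e => ?_
  exact (K0.cast_mul _ _ _ _).trans (K0.one_mul' _ _ rfl _)

theorem gradedK0_mul_comm (a b : GradedMonoid (GradedK0 f)) : a * b = b * a := by
  obtain ⟨i, a⟩ := a
  obtain ⟨j, b⟩ := b
  refine gradedK0_ext (add_comm i j) (K0.mul (add_smul i j f).symm a b)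
    (K0.mul (add_smul j i f).symm b a) fun e => ?_
  exact (K0.cast_mul _ _ _ _).trans (K0.mul_comm' _ _ _ _)

theorem gradedK0_mul_assoc (a b c : GradedMonoid (GradedK0 f)) : a * b * c = a * (b * c) := by
  obtain ⟨i, a⟩ := a
  obtain ⟨j, b⟩ := b
  obtain ⟨l, c⟩ := c
  refine gradedK0_ext (add_assoc i j l)
    (K0.mul (add_smul (i + j) l f).symm (K0.mul (add_smul i j f).symm a b) c)
    (K0.mul (add_smul i (j + l) f).symm a (K0.mul (add_smul j l f).symm b c)) fun e => ?_
  exact (K0.cast_mul _ _ _ _).trans (K0.mul_assoc' _ _ _ _ _ _ _)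

noncomputable instance (f : Q) : DirectSum.GCommRing (GradedK0 f) where
  mul_zero {i j} a := (K0.mul (add_smul i j f).symm a).map_zero
  zero_mul {i j} b := ((K0.mul (add_smul i j f).symm).flip b).map_zero
  mul_add {i j} a b c := (K0.mul (add_smul i j f).symm a).map_add b c
  add_mul {i j} a b c := ((K0.mul (add_smul i j f).symm).flip c).map_add a b
  one_mul := gradedK0_one_mul
  mul_one a := by rw [gradedK0_mul_comm, gradedK0_one_mul]
  mul_assoc := gradedK0_mul_assoc
  mul_comm := gradedK0_mul_comm
  natCast m := m • (GradedMonoid.GOne.one : GradedK0 f 0)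
  natCast_zero := zero_smul _ _
  natCast_succ m := succ_nsmul _ m
  intCast m := m • (GradedMonoid.GOne.one : GradedK0 f 0)
  intCast_ofNat m := natCast_zsmul _ m
  intCast_negSucc_ofNat m := negSucc_zsmul _ m

/-- The ring `K_f(Q) = ⨁ i ≥ 0, K_0([MF(Q, i f)])` with product `[E] · [F] = [E ⊗ F]`. -/
abbrev Kf (f : Q) : Type (u + 1) := ⨁ i : ℕ, GradedK0 f i

/-- The class in `K_f(Q)` of a matrix factorization of `i f`. -/
noncomputable def Kf.of {i : ℕ} (E : MatrixFactorization Q (i • f)) : Kf f :=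
  DirectSum.of (GradedK0 f) i (K0.of E : K0 (i • f))

theorem Kf.of_mul_of {i j : ℕ} (E : MatrixFactorization Q (i • f))
    (F : MatrixFactorization Q (j • f)) :
    Kf.of E * Kf.of F = Kf.of (E.tensor F (add_smul i j f).symm) :=
  (DirectSum.of_mul_of (A := GradedK0 f) _ _).trans
    (congrArg (DirectSum.of (GradedK0 f) (i + j)) (K0.mul_of (add_smul i j f).symm E F))

theorem Kf.one_eq : (1 : Kf f) = Kf.of (unit Q (zero_smul ℕ f)) := rfl

end MatrixFactorization

namespace MatrixFactorization

open KaehlerDifferential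

variable (k : Type v) {Q : Type u} [CommRing k] [CommRing Q] [Algebra k Q]

/-- The exterior algebra `Ω^• = ⨁ Ω^i` of `Ω^1 = Ω[Q⁄k]` over `Q`. -/
abbrev Forms (k : Type v) (Q : Type u) [CommRing k] [CommRing Q] [Algebra k Q] : Type u :=
  ExteriorAlgebra Q (Ω[Q⁄k])

/-- The sum of the `Ω^i` with `i ∈ S`. -/
noncomputable def formsIn (k : Type v) (Q : Type u) [CommRing k] [CommRing Q] [Algebra k Q] (S : Set ℕ) :
    Submodule Q (Forms k Q) :=
  ⨆ i ∈ S, ⋀[Q]^i (Ω[Q⁄k])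

/-- The 1-form `df` in `Ω^•`. -/
noncomputable def dForm (f : Q) : Forms k Q := ExteriorAlgebra.ι Q (D k Q f)

/-- Even cycles of the `ℤ/2`-folding of `(Ω^•, df, n) : Q → Ω^1 → ⋯ → Ω^n`. The truncation of `Ω^•`
above degree `n` is expressed by working modulo the forms of degree `> n`: these are added both
to the cycles and to the boundaries. (They vanish when `Ω^1` is projective of rank `n`.) -/
noncomputable def cycles (n : ℕ) (f : Q) : Submodule Q (Forms k Q) :=
  formsIn k Q {i | Even i} ⊓
    (formsIn k Q {i | n < i}).comap (LinearMap.mulLeft Q (dForm k f))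

/-- Even boundaries of the `ℤ/2`-folding of `(Ω^•, df, n)`, together with the even forms of
degree `> n`. -/
noncomputable def boundaries (n : ℕ) (f : Q) : Submodule Q (Forms k Q) :=
  (formsIn k Q {i | Odd i}).map (LinearMap.mulLeft Q (dForm k f)) ⊔
    (formsIn k Q {i | Even i} ⊓ formsIn k Q {i | n < i})

/-- `H_0` of the `ℤ/2`-folding of the complex
`Q → Ω^1 → ⋯ → Ω^n` whose differential is `df ∧ -`. -/
noncomputable def H0 (n : ℕ) (f : Q) : Type u :=
  cycles k n f ⧸ (boundaries k n f).submoduleOf (cycles k n f)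

variable {k} {n : ℕ} {f g h : Q}

noncomputable instance : AddCommGroup (H0 k n f) :=
  inferInstanceAs (AddCommGroup (_ ⧸ (boundaries k n f).submoduleOf (cycles k n f)))

noncomputable instance : Module Q (H0 k n f) :=
  inferInstanceAs (Module Q (_ ⧸ (boundaries k n f).submoduleOf (cycles k n f)))

/-- The homology class of a cycle. -/
noncomputable def H0.mk : cycles k n f →ₗ[Q] H0 k n f :=
  ((boundaries k n f).submoduleOf (cycles k n f)).mkQ

theorem H0.mk_surjective : Function.Surjective (H0.mk : cycles k n f →ₗ[Q] H0 k n f) :=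
  Submodule.mkQ_surjective _

theorem H0.mk_eq_zero {x : cycles k n f} (hx : (x : Forms k Q) ∈ boundaries k n f) :
    H0.mk x = 0 :=
  (Submodule.Quotient.mk_eq_zero _).2 hx

theorem formsIn_mul_mem {S T U : Set ℕ} (H : ∀ i ∈ S, ∀ j ∈ T, i + j ∈ U) {x y : Forms k Q}
    (hx : x ∈ formsIn k Q S) (hy : y ∈ formsIn k Q T) : x * y ∈ formsIn k Q U := by
  have : formsIn k Q S * formsIn k Q T ≤ formsIn k Q U := by
    simp only [formsIn, Submodule.iSup_mul, Submodule.mul_iSup]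
    refine iSup₂_le fun j hj => iSup₂_le fun i hi => ?_
    rw [← pow_add]
    exact le_iSup₂_of_le (i + j) (H i hi j hj) le_rfl
  exact this (Submodule.mul_mem_mul hx hy)

theorem formsIn_mono {S T : Set ℕ} (H : S ⊆ T) : formsIn k Q S ≤ formsIn k Q T :=
  iSup₂_le fun i hi => le_iSup₂_of_le i (H hi) le_rfl

theorem ι_mul_pow (m : Ω[Q⁄k]) (i : ℕ) (x : Forms k Q) (hx : x ∈ ⋀[Q]^i (Ω[Q⁄k])) :
    ExteriorAlgebra.ι Q m * x = (-1 : ℤ) ^ i • (x * ExteriorAlgebra.ι Q m) := by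
  induction hx using Submodule.pow_induction_on_left' with
  | algebraMap r => simp [Algebra.commutes]
  | add x y i hx hy h1 h2 => simp only [mul_add, add_mul, h1, h2, smul_add]
  | mem_mul a ha i x hx ih =>
    obtain ⟨a, rfl⟩ := ha
    have := ExteriorAlgebra.ι_add_mul_swap (R := Q) m a
    rw [← mul_assoc, eq_neg_of_add_eq_zero_left this, neg_mul, mul_assoc, ih, pow_succ,
      mul_smul_comm, mul_assoc]
    simp

theorem ι_mul_even (m : Ω[Q⁄k]) {x : Forms k Q} (hx : x ∈ formsIn k Q {i | Even i}) :
    ExteriorAlgebra.ι Q m * x = x * ExteriorAlgebra.ι Q m := by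
  have : formsIn k Q {i | Even i} ≤
      LinearMap.ker (LinearMap.mulLeft Q (ExteriorAlgebra.ι Q m : Forms k Q) -
        LinearMap.mulRight Q (ExteriorAlgebra.ι Q m)) := by
    refine iSup₂_le fun i hi x hx => ?_
    have := ι_mul_pow m i x hx
    rw [Even.neg_one_pow hi, one_smul] at this
    simp [this]
  simpa [sub_eq_zero] using this hx

theorem ι_mul_odd (m : Ω[Q⁄k]) {x : Forms k Q} (hx : x ∈ formsIn k Q {i | Odd i}) :
    ExteriorAlgebra.ι Q m * x = -(x * ExteriorAlgebra.ι Q m) := by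
  have : formsIn k Q {i | Odd i} ≤
      LinearMap.ker (LinearMap.mulLeft Q (ExteriorAlgebra.ι Q m : Forms k Q) +
        LinearMap.mulRight Q (ExteriorAlgebra.ι Q m)) := by
    refine iSup₂_le fun i hi x hx => ?_
    have := ι_mul_pow m i x hx
    rw [Odd.neg_one_pow hi, neg_smul, one_smul] at this
    simp [this]
  simpa [add_eq_zero_iff_eq_neg] using this hx

theorem even_mul_comm {x : Forms k Q} (hx : x ∈ formsIn k Q {i | Even i}) (y : Forms k Q) :
    y * x = x * y := by
  induction y using ExteriorAlgebra.induction with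
  | algebraMap r => exact Algebra.commutes r x
  | ι m => exact ι_mul_even m hx
  | mul a b ha hb => rw [mul_assoc, hb, ← mul_assoc, ha, mul_assoc]
  | add a b ha hb => rw [add_mul, mul_add, ha, hb]

theorem dForm_add (e : f + g = h) : dForm k h = dForm k f + dForm k g := by
  subst e; simp [dForm]

theorem dForm_mem (f : Q) : dForm k f ∈ formsIn k Q {1} :=
  le_iSup₂_of_le (f := fun i (_ : i ∈ ({1} : Set ℕ)) => ⋀[Q]^i (Ω[Q⁄k])) 1
    (Set.mem_singleton 1) le_rfl (by simp [dForm])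

theorem one_mem_cycles (hf : f = 0) : (1 : Forms k Q) ∈ cycles k n f := by
  subst hf
  refine ⟨?_, by simp [dForm]⟩
  exact le_iSup₂_of_le (f := fun i (_ : i ∈ {i | Even i}) => ⋀[Q]^i (Ω[Q⁄k])) 0
    (show Even 0 from ⟨0, rfl⟩) le_rfl (by simp)

theorem mul_mem_cycles (e : f + g = h) {x y : Forms k Q} (hx : x ∈ cycles k n f)
    (hy : y ∈ cycles k n g) : x * y ∈ cycles k n h := by
  refine ⟨formsIn_mul_mem (fun i hi j hj => Even.add hi hj) hx.1 hy.1, ?_⟩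
  have h1 : dForm k f * x ∈ formsIn k Q {i | n < i} := hx.2
  have h2 : dForm k g * y ∈ formsIn k Q {i | n < i} := hy.2
  have h3 : dForm k h * (x * y) = dForm k f * x * y + x * (dForm k g * y) := by
    rw [dForm_add e, add_mul, ← mul_assoc x, ← even_mul_comm hx.1 (dForm k g)]
    simp only [mul_assoc]
  change dForm k h * (x * y) ∈ formsIn k Q {i | n < i}
  rw [h3]
  refine add_mem (formsIn_mul_mem (fun i hi j _ => ?_) h1 hy.1)
    (formsIn_mul_mem (fun i _ j hj => ?_) hx.1 h2)
  · exact lt_of_lt_of_le hi (Nat.le_add_right i j)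
  · exact lt_of_lt_of_le hj (Nat.le_add_left j i)

theorem mul_mem_boundaries (e : f + g = h) {x y : Forms k Q} (hx : x ∈ boundaries k n f)
    (hy : y ∈ cycles k n g) : x * y ∈ boundaries k n h := by
  obtain ⟨_, ⟨z, hz, rfl⟩, w, hw, rfl⟩ := Submodule.mem_sup.1 hx
  have h2 : dForm k g * y ∈ formsIn k Q {i | n < i} := hy.2
  have h1 : dForm k g * z = -(z * dForm k g) := ι_mul_odd _ hz
  have h3 : (LinearMap.mulLeft Q (dForm k f) z + w) * y =
      dForm k h * (z * y) + (z * (dForm k g * y) + w * y) := by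
    rw [LinearMap.mulLeft_apply, dForm_add e, add_mul, add_mul, ← mul_assoc (dForm k g), h1]
    simp only [mul_assoc, neg_mul]
    abel
  rw [h3]
  refine Submodule.add_mem_sup ⟨_, formsIn_mul_mem (fun i hi j hj => Odd.add_even hi hj) hz hy.1,
    rfl⟩ (add_mem ⟨?_, ?_⟩ ⟨?_, ?_⟩)
  · refine formsIn_mul_mem (fun i hi j hj => Odd.add_odd hi hj) hz (T := {i | Odd i}) ?_
    refine formsIn_mul_mem (fun i hi j hj => ?_) (dForm_mem g) hy.1
    rw [Set.mem_singleton_iff.1 hi]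
    exact Odd.add_even odd_one hj
  · exact formsIn_mul_mem (fun i hi j hj => lt_of_lt_of_le hj (Nat.le_add_left j i)) hz h2
  · exact formsIn_mul_mem (fun i hi j hj => Even.add hi hj) hw.1 hy.1
  · exact formsIn_mul_mem (fun i hi j hj => lt_of_lt_of_le hi (Nat.le_add_right i j)) hw.2 hy.1

/-- The wedge product of even cycles. -/
noncomputable def mulCycles (e : f + g = h) :
    cycles k n f →ₗ[Q] cycles k n g →ₗ[Q] cycles k n h :=
  LinearMap.mk₂ Q (fun x y => ⟨x.1 * y.1, mul_mem_cycles e x.2 y.2⟩)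
    (fun _ _ _ => Subtype.ext (add_mul _ _ _)) (fun _ _ _ => Subtype.ext (smul_mul_assoc _ _ _))
    (fun _ _ _ => Subtype.ext (mul_add _ _ _)) (fun _ _ _ => Subtype.ext (mul_smul_comm _ _ _))

/-- The product on homology induced by the wedge product. -/
noncomputable def H0.mul (e : f + g = h) : H0 k n f →ₗ[Q] H0 k n g →ₗ[Q] H0 k n h :=
  Submodule.liftQ _ (LinearMap.flip (Submodule.liftQ _ (LinearMap.flip
    ((mulCycles (k := k) (n := n) e).compr₂ H0.mk)) (fun y hy => by
      ext x
      refine H0.mk_eq_zero ?_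
      change x.1 * y.1 ∈ boundaries k n h
      rw [← even_mul_comm x.2.1]
      exact mul_mem_boundaries (by rw [add_comm, e]) hy x.2))) (fun x hx => by
      refine LinearMap.ext fun y => ?_
      obtain ⟨y, rfl⟩ := H0.mk_surjective y
      exact H0.mk_eq_zero (mul_mem_boundaries e hx y.2))

theorem H0.mul_mk (e : f + g = h) (x : cycles k n f) (y : cycles k n g) :
    H0.mul e (H0.mk x) (H0.mk y) = H0.mk ⟨x.1 * y.1, mul_mem_cycles e x.2 y.2⟩ := rfl

variable (k n) in
/-- The group `H_0((Ω^•, i df, n)_{ℤ/2})`. -/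
def GradedH0 (f : Q) (i : ℕ) : Type u := H0 k n (i • f)

noncomputable instance (f : Q) (i : ℕ) : AddCommGroup (GradedH0 k n f i) :=
  inferInstanceAs (AddCommGroup (H0 k n _))

theorem gradedH0_ext {i j : ℕ} (hij : i = j) (x : cycles k n (i • f)) (y : cycles k n (j • f))
    (H : (x : Forms k Q) = y) :
    GradedMonoid.mk (A := GradedH0 k n f) i (H0.mk x) =
      GradedMonoid.mk (A := GradedH0 k n f) j (H0.mk y) := by
  subst hij
  rw [Subtype.ext H]

noncomputable instance (f : Q) : GradedMonoid.GMul (GradedH0 k n f) where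
  mul {i j} x y := H0.mul (add_smul i j f).symm x y

noncomputable instance (f : Q) : GradedMonoid.GOne (GradedH0 k n f) where
  one := H0.mk ⟨1, one_mem_cycles (zero_smul ℕ f)⟩

theorem gradedH0_one_mul (a : GradedMonoid (GradedH0 k n f)) : 1 * a = a := by
  obtain ⟨i, a⟩ := a
  obtain ⟨a, rfl⟩ := H0.mk_surjective a
  exact gradedH0_ext (zero_add i) ⟨1 * a.1, mul_mem_cycles (add_smul 0 i f).symm
    (one_mem_cycles (zero_smul ℕ f)) a.2⟩ a (one_mul _)

theorem gradedH0_mul_comm (a b : GradedMonoid (GradedH0 k n f)) : a * b = b * a := by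
  obtain ⟨i, a⟩ := a
  obtain ⟨j, b⟩ := b
  obtain ⟨a, rfl⟩ := H0.mk_surjective a
  obtain ⟨b, rfl⟩ := H0.mk_surjective b
  exact gradedH0_ext (add_comm i j) ⟨a.1 * b.1, mul_mem_cycles (add_smul i j f).symm a.2 b.2⟩
    ⟨b.1 * a.1, mul_mem_cycles (add_smul j i f).symm b.2 a.2⟩ (even_mul_comm b.2.1 a.1)

theorem gradedH0_mul_assoc (a b c : GradedMonoid (GradedH0 k n f)) :
    a * b * c = a * (b * c) := by
  obtain ⟨i, a⟩ := a
  obtain ⟨j, b⟩ := b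
  obtain ⟨l, c⟩ := c
  obtain ⟨a, rfl⟩ := H0.mk_surjective a
  obtain ⟨b, rfl⟩ := H0.mk_surjective b
  obtain ⟨c, rfl⟩ := H0.mk_surjective c
  exact gradedH0_ext (add_assoc i j l)
    ⟨a.1 * b.1 * c.1, mul_mem_cycles (add_smul (i + j) l f).symm
      (mul_mem_cycles (add_smul i j f).symm a.2 b.2) c.2⟩
    ⟨a.1 * (b.1 * c.1), mul_mem_cycles (add_smul i (j + l) f).symm a.2
      (mul_mem_cycles (add_smul j l f).symm b.2 c.2)⟩ (mul_assoc _ _ _)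

noncomputable instance (f : Q) : DirectSum.GCommRing (GradedH0 k n f) where
  mul_zero {i j} a := (H0.mul (add_smul i j f).symm a).map_zero
  zero_mul {i j} b := ((H0.mul (add_smul i j f).symm).flip b).map_zero
  mul_add {i j} a b c := (H0.mul (add_smul i j f).symm a).map_add b c
  add_mul {i j} a b c := ((H0.mul (add_smul i j f).symm).flip c).map_add a b
  one_mul := gradedH0_one_mul
  mul_one a := by rw [gradedH0_mul_comm, gradedH0_one_mul]
  mul_assoc := gradedH0_mul_assoc
  mul_comm := gradedH0_mul_comm
  natCast m := m • (GradedMonoid.GOne.one : GradedH0 k n f 0)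
  natCast_zero := zero_smul _ _
  natCast_succ m := succ_nsmul _ m
  intCast m := m • (GradedMonoid.GOne.one : GradedH0 k n f 0)
  intCast_ofNat m := natCast_zsmul _ m
  intCast_negSucc_ofNat m := negSucc_zsmul _ m

variable (k n) in
/-- The ring `⨁ i ≥ 0, H_0((Ω^•, i df, n)_{ℤ/2})` with product induced by the wedge product. -/
abbrev Hf (f : Q) : Type u := ⨁ i : ℕ, GradedH0 k n f i

/-- The homology class of an even cycle of the folded complex `(Ω^•, i df, n)`, as an element of
the `i`-th summand. -/
noncomputable def Hf.of {i : ℕ} (z : Forms k Q) (hz : z ∈ cycles k n (i • f)) : Hf k n f :=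
  DirectSum.of (GradedH0 k n f) i (H0.mk ⟨z, hz⟩ : H0 k n (i • f))

theorem Hf.of_mul_of {i j : ℕ} {y z : Forms k Q} (hy : y ∈ cycles k n (i • f))
    (hz : z ∈ cycles k n (j • f)) :
    (Hf.of y hy * Hf.of z hz : Hf k n f) =
      Hf.of (y * z) (mul_mem_cycles (add_smul i j f).symm hy hz) :=
  DirectSum.of_mul_of (A := GradedH0 k n f) _ _

theorem Hf.one_eq :
    (1 : Hf k n f) = Hf.of (1 : Forms k Q) (one_mem_cycles (zero_smul ℕ f)) := rfl

end MatrixFactorization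

namespace MatrixFactorization

open KaehlerDifferential

theorem boundaries_le_cycles (k : Type v) {Q : Type u} [CommRing k] [CommRing Q] [Algebra k Q]
    (n : ℕ) (f : Q) : boundaries k n f ≤ cycles k n f := by
  refine sup_le ?_ fun x hx => ⟨hx.1, ?_⟩
  · rintro _ ⟨z, hz, rfl⟩
    refine ⟨formsIn_mul_mem (fun i hi j hj => ?_) (dForm_mem f) hz, ?_⟩
    · rw [Set.mem_singleton_iff.1 hi]
      exact Odd.add_odd odd_one hj
    · change dForm k f * (dForm k f * z) ∈ formsIn k Q {i | n < i}
      rw [← mul_assoc, dForm, ExteriorAlgebra.ι_sq_zero, zero_mul]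
      exact zero_mem _
  · exact formsIn_mul_mem (fun i _ j hj => lt_of_lt_of_le hj (Nat.le_add_left j i))
      (dForm_mem f) hx.2

variable (k : Type v) (Q : Type u) [CommRing k] [CommRing Q] [Algebra k Q]

/-- A connection on a `Q`-module `E`: an additive map `∇ : E → Ω^1 ⊗ E` satisfying the Leibniz
rule. Such a map is automatically `k`-linear, because `d` vanishes on the image of `k`. -/
structure Connection (E : Type u) [AddCommGroup E] [Module Q E] where
  toFun : E →+ Ω[Q⁄k] ⊗[Q] E
  leibniz : ∀ (q : Q) (x : E), toFun (q • x) = D k Q q ⊗ₜ[Q] x + q • toFun x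

variable {k Q} {f : Q}

/-- The odd endomorphism `d` of the total module `E0 ⊕ E1`. -/
def totalD (E : MatrixFactorization Q f) : E.M0 × E.M1 →ₗ[Q] E.M0 × E.M1 :=
  LinearMap.prod (E.d1 ∘ₗ LinearMap.snd Q E.M0 E.M1) (E.d0 ∘ₗ LinearMap.fst Q E.M0 E.M1)

/-- The connection on `E0 ⊕ E1` induced by connections on `E0` and `E1`. -/
noncomputable def totalConnection (E : MatrixFactorization Q f) (nabla0 : Connection k Q E.M0)
    (nabla1 : Connection k Q E.M1) : Connection k Q (E.M0 × E.M1) where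
  toFun :=
    (((LinearMap.inl Q E.M0 E.M1).lTensor (Ω[Q⁄k])).toAddMonoidHom.comp nabla0.toFun).coprod
    (((LinearMap.inr Q E.M0 E.M1).lTensor (Ω[Q⁄k])).toAddMonoidHom.comp nabla1.toFun)
  leibniz q x := by
    obtain ⟨x, y⟩ := x
    have : ((x, y) : E.M0 × E.M1) = (x, 0) + (0, y) := by simp
    simp only [AddMonoidHom.coprod_apply, Prod.smul_mk, AddMonoidHom.comp_apply, nabla0.leibniz,
      nabla1.leibniz, map_add, LinearMap.toAddMonoidHom_coe, LinearMap.lTensor_tmul, map_smul]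
    rw [this, TensorProduct.tmul_add, smul_add]
    simp only [LinearMap.inl_apply, LinearMap.inr_apply]
    abel

/-- The Atiyah class `At = ∇ ∘ d - (1 ⊗ d) ∘ ∇ : E → Ω^1 ⊗ E`. -/
noncomputable def atiyah (E : MatrixFactorization Q f) (nabla0 : Connection k Q E.M0)
    (nabla1 : Connection k Q E.M1) : E.M0 × E.M1 →ₗ[Q] Ω[Q⁄k] ⊗[Q] (E.M0 × E.M1) where
  toFun x := (totalConnection E nabla0 nabla1).toFun (E.totalD x) -
    E.totalD.lTensor (Ω[Q⁄k]) ((totalConnection E nabla0 nabla1).toFun x)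
  map_add' x y := by simp only [map_add]; abel
  map_smul' q x := by
    simp only [map_smul, Connection.leibniz, map_add, LinearMap.lTensor_tmul, RingHom.id_apply,
      smul_sub]
    abel

/-- The map `ω ⊗ x ↦ ω ∧ At(x)` from `Ω^• ⊗ E` to `Ω^• ⊗ E`. -/
noncomputable def wedgeAtiyah (E : MatrixFactorization Q f) (nabla0 : Connection k Q E.M0)
    (nabla1 : Connection k Q E.M1) :
    Forms k Q ⊗[Q] (E.M0 × E.M1) →ₗ[Q] Forms k Q ⊗[Q] (E.M0 × E.M1) :=
  (LinearMap.mul' Q (Forms k Q)).rTensor (E.M0 × E.M1) ∘ₗ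
    (TensorProduct.assoc Q (Forms k Q) (Forms k Q) (E.M0 × E.M1)).symm.toLinearMap ∘ₗ
    ((ExteriorAlgebra.ι Q).rTensor (E.M0 × E.M1) ∘ₗ E.atiyah nabla0 nabla1).lTensor (Forms k Q)

/-- The power `At^i : E → Ω^i ⊗ E ⊆ Ω^• ⊗ E`: the `i`-fold composite of the Atiyah class followed
by the wedge product. -/
noncomputable def atiyahPow (E : MatrixFactorization Q f) (nabla0 : Connection k Q E.M0)
    (nabla1 : Connection k Q E.M1) : ℕ → (E.M0 × E.M1 →ₗ[Q] Forms k Q ⊗[Q] (E.M0 × E.M1))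
  | 0 => TensorProduct.mk Q (Forms k Q) (E.M0 × E.M1) 1
  | i + 1 => E.wedgeAtiyah nabla0 nabla1 ∘ₗ atiyahPow E nabla0 nabla1 i

end MatrixFactorization

/-- The trace `Hom(M, W ⊗ M) ≃ M^* ⊗ (W ⊗ M) → W` of a finitely generated projective module `M`
with coefficients in `W`, where the last map is `α ⊗ (w ⊗ m) ↦ α(m) w`. -/
noncomputable def traceWith (Q : Type u) [CommRing Q] (M W : Type u) [AddCommGroup M] [Module Q M]
    [Module.Finite Q M] [Module.Projective Q M] [AddCommGroup W] [Module Q W] :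
    (M →ₗ[Q] W ⊗[Q] M) →ₗ[Q] W :=
  TensorProduct.lift
    ((LinearMap.lTensorHom W).compr₂ (TensorProduct.rid Q W).toLinearMap) ∘ₗ
    (dualTensorHomEquiv Q M (W ⊗[Q] M)).symm.toLinearMap

namespace MatrixFactorization

open KaehlerDifferential

variable {k : Type v} {Q : Type u} [CommRing k] [CommRing Q] [Algebra k Q] {f : Q}

/-- The supertrace `tr(T_00) - tr(T_11) ∈ Ω^•` of `T : E → Ω^• ⊗ E`. -/
noncomputable def supertrace (E : MatrixFactorization Q f)
    (T : E.M0 × E.M1 →ₗ[Q] Forms k Q ⊗[Q] (E.M0 × E.M1)) : Forms k Q :=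
  traceWith Q E.M0 (Forms k Q)
    ((LinearMap.fst Q E.M0 E.M1).lTensor (Forms k Q) ∘ₗ T ∘ₗ LinearMap.inl Q E.M0 E.M1) -
  traceWith Q E.M1 (Forms k Q)
    ((LinearMap.snd Q E.M0 E.M1).lTensor (Forms k Q) ∘ₗ T ∘ₗ LinearMap.inr Q E.M0 E.M1)

/-- The form `∑_{i ≤ n} (1 / i!) str(At^i)` representing the Chern character. -/
noncomputable def chernForm [Algebra ℚ k] (n : ℕ) (E : MatrixFactorization Q f)
    (nabla0 : Connection k Q E.M0) (nabla1 : Connection k Q E.M1) : Forms k Q :=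
  ∑ i ∈ Finset.range (n + 1), algebraMap k Q (algebraMap ℚ k (1 / (i.factorial : ℚ))) •
    E.supertrace (E.atiyahPow nabla0 nabla1 i)

end MatrixFactorization

/-- `Q` is a smooth `k`-algebra of relative dimension `n`: it is smooth and the (finitely generated
projective) `Q`-module `Ω[Q⁄k]` has rank `n` at every prime. -/
def IsSmoothOfRelativeDimension (k : Type v) (Q : Type u) [CommRing k] [CommRing Q] [Algebra k Q]
    (n : ℕ) : Prop :=
  Algebra.Smooth k Q ∧ ∀ p : PrimeSpectrum Q, Module.rankAtStalk (Ω[Q⁄k]) p = n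

/-! The argument takes place among the endomorphisms of Ω^• ⊗ E, with forms on the left. Let D = 1 ⊗
d (`extD`), let A send ω ⊗ x to ω ∧ At(x) (`extAtiyah`), let F multiply forms on the right by df
(`mulD`), and let Γ be the parity of E (`extParity`). The failure of a linear map to commute with
connections is a derivation with respect to composition (`Connection.defect_comp`); applied to d² =
f it yields DA + AD = F. Moreover A anticommutes with F, and Γ anticommutes with A and D. The
supertrace is str(T) = tr(ΓT), and str(DT) = -str(TD).

The basic identity is D A^(j+1) = (-1)^(j+1) A^(j+1) D + (j+1) F A^j (`mul_pow_succ_of_anticomm`).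
For even j its supertrace reads (j+1) str(A^j) ∧ df = 0, and for odd j already str(A^j) = 0.
Division by integers then makes each str(At^j) a cycle.

For a homotopy equivalence α : E → E' with inverse β, possibly with unrelated connections, A'^j α -
α A^j is a commutator with D up to a multiple of F' (`exists_intertwining`), and αβ, βα differ from
the identity by an anticommutator DH + HD. Supertraces kill the terms with D and turn those with F
into boundaries. This proves homotopy invariance and, for α = β = id, independence of the
connections.

That freedom is used to choose convenient connections. Direct sums on a cone make the canonical maps
horizontal, and the Chern forms add exactly (`chernForm_cone`). On E ⊗ F the Atiyah operator becomes
a sum of two commuting operators, so the binomial theorem and multiplicativity of the trace give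
str(At^j) as a binomial sum (`strAtiyah_tensor`); the factors 1/j! make the Chern form behave as an
exponential, up to forms of degree > n, which are boundaries by definition (`chernForm_tensor`).
Uniqueness holds because classes of objects generate K_f(Q) additively. -/

namespace MatrixFactorization

/-! ### Traces with coefficients on finitely generated projective modules. -/

section Trace

variable {Q : Type u} [CommRing Q] {M N W W' : Type u} [AddCommGroup M] [Module Q M]
  [AddCommGroup N] [Module Q N] [AddCommGroup W] [Module Q W] [AddCommGroup W'] [Module Q W']
  [Module.Finite Q M] [Module.Projective Q M]

theorem traceWith_dualTensorHom (φ : Module.Dual Q M) (z : W ⊗[Q] M) :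
    traceWith Q M W (dualTensorHom Q M (W ⊗[Q] M) (φ ⊗ₜ z)) =
      TensorProduct.rid Q W (φ.lTensor W z) := by
  have : dualTensorHom Q M (W ⊗[Q] M) (φ ⊗ₜ z) =
    dualTensorHomEquiv Q M (W ⊗[Q] M) (φ ⊗ₜ z) := by simp
  rw [this]
  simp only [traceWith, LinearMap.comp_apply, LinearEquiv.coe_coe, LinearEquiv.symm_apply_apply]
  rfl

/-- A linear map out of a finitely generated projective module is a sum of maps of rank one. -/
theorem hom_induction {p : (M →ₗ[Q] N) → Prop} (T : M →ₗ[Q] N) (zero : p 0)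
    (tmul : ∀ (φ : Module.Dual Q M) (z : N), p (dualTensorHom Q M N (φ ⊗ₜ z)))
    (add : ∀ S T, p S → p T → p (S + T)) : p T := by
  obtain ⟨t, rfl⟩ := (dualTensorHomEquiv Q M N).surjective T
  induction t with
  | zero => simpa using zero
  | tmul φ z => simpa using tmul φ z
  | add s t hs ht => rw [map_add]; exact add _ _ hs ht

/-- Both sides are linear in `S`, and for `S` of rank one each is the contraction of `ψ ∘ φ` with
`z`. Since `φ` has no coefficients in `W`, no products in `W` have to be exchanged. -/
theorem traceWith_comp_comm [Module.Finite Q N] [Module.Projective Q N]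
    (S : M →ₗ[Q] W ⊗[Q] N) (φ : N →ₗ[Q] M) :
    traceWith Q M W (φ.lTensor W ∘ₗ S) = traceWith Q N W (S ∘ₗ φ) := by
  induction S using hom_induction with
  | zero => simp
  | add S T hS hT => rw [LinearMap.comp_add, LinearMap.add_comp, map_add, map_add, hS, hT]
  | tmul ψ z =>
    have h1 : φ.lTensor W ∘ₗ dualTensorHom Q M (W ⊗[Q] N) (ψ ⊗ₜ z) =
        dualTensorHom Q M (W ⊗[Q] M) (ψ ⊗ₜ φ.lTensor W z) := by ext; simp
    have h2 : dualTensorHom Q M (W ⊗[Q] N) (ψ ⊗ₜ z) ∘ₗ φ =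
        dualTensorHom Q N (W ⊗[Q] N) ((ψ ∘ₗ φ) ⊗ₜ z) := by ext; simp
    rw [h1, h2, traceWith_dualTensorHom, traceWith_dualTensorHom, LinearMap.lTensor_comp]
    rfl

theorem traceWith_rTensor_comp (g : W →ₗ[Q] W') (T : M →ₗ[Q] W ⊗[Q] M) :
    traceWith Q M W' (g.rTensor M ∘ₗ T) = g (traceWith Q M W T) := by
  induction T using hom_induction with
  | zero => simp
  | add S T hS hT => rw [LinearMap.comp_add, map_add, map_add, map_add, hS, hT]
  | tmul ψ z =>
    have h1 : g.rTensor M ∘ₗ dualTensorHom Q M (W ⊗[Q] M) (ψ ⊗ₜ z) =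
        dualTensorHom Q M (W' ⊗[Q] M) (ψ ⊗ₜ g.rTensor M z) := by ext; simp
    rw [h1, traceWith_dualTensorHom, traceWith_dualTensorHom]
    induction z with
    | zero => simp
    | tmul w m => simp
    | add a b ha hb =>
      simp only [map_add] at ha hb ⊢
      rw [ha (by ext; simp), hb (by ext; simp)]

/-- Projectivity of `M` lifts `T` through the surjection of S ⊗ M onto its image in W ⊗ M, and the
trace is natural in the coefficients. -/
theorem traceWith_mem (S : Submodule Q W) (T : M →ₗ[Q] W ⊗[Q] M)
    (hT : ∀ x, T x ∈ LinearMap.range (S.subtype.rTensor M)) : traceWith Q M W T ∈ S := by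
  obtain ⟨T', h⟩ := Module.projective_lifting_property (S.subtype.rTensor M).rangeRestrict
    (T.codRestrict _ hT) (LinearMap.surjective_rangeRestrict _)
  have : T = S.subtype.rTensor M ∘ₗ T' := by
    ext x
    exact (congrArg Subtype.val (LinearMap.congr_fun h x)).symm
  rw [this, traceWith_rTensor_comp]
  exact Subtype.prop _

end Trace

/-! ### Operators on Ω^• ⊗ M, their form degree and their trace. -/

section Forms

open KaehlerDifferential

variable {k : Type v} {Q : Type u} [CommRing k] [CommRing Q] [Algebra k Q]
  {M N P : Type u} [AddCommGroup M] [Module Q M] [AddCommGroup N] [Module Q N]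
  [AddCommGroup P] [Module Q P]

/-- The extension of `T : M → Ω^1 ⊗ N` to `Ω^• ⊗ M → Ω^• ⊗ N`, `ω ⊗ x ↦ ω ∧ T x`. -/
noncomputable def wedge (T : M →ₗ[Q] Ω[Q⁄k] ⊗[Q] N) : Forms k Q ⊗[Q] M →ₗ[Q] Forms k Q ⊗[Q] N :=
  (LinearMap.mul' Q (Forms k Q)).rTensor N ∘ₗ
    (TensorProduct.assoc Q (Forms k Q) (Forms k Q) N).symm.toLinearMap ∘ₗ
    ((ExteriorAlgebra.ι Q).rTensor N ∘ₗ T).lTensor (Forms k Q)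

theorem wedge_tmul (T : M →ₗ[Q] Ω[Q⁄k] ⊗[Q] N) (ω : Forms k Q) (x : M) :
    wedge T (ω ⊗ₜ x) = (LinearMap.mulLeft Q ω ∘ₗ ExteriorAlgebra.ι Q).rTensor N (T x) := by
  simp only [wedge, LinearMap.comp_apply, LinearMap.lTensor_tmul]
  induction T x with
  | zero => simp
  | tmul v y => simp
  | add a b ha hb => simp only [map_add, TensorProduct.tmul_add, ha, hb]

theorem wedge_add (S T : M →ₗ[Q] Ω[Q⁄k] ⊗[Q] N) : wedge (S + T) = wedge S + wedge T := by
  refine TensorProduct.ext' fun ω x => ?_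
  simp [wedge_tmul]

theorem wedge_neg (T : M →ₗ[Q] Ω[Q⁄k] ⊗[Q] N) : wedge (-T) = -wedge T := by
  refine TensorProduct.ext' fun ω x => ?_
  simp [wedge_tmul]

theorem wedge_comp (T : N →ₗ[Q] Ω[Q⁄k] ⊗[Q] P) (φ : M →ₗ[Q] N) :
    wedge (T ∘ₗ φ) = wedge T ∘ₗ φ.lTensor (Forms k Q) := by
  refine TensorProduct.ext' fun ω x => ?_
  simp [wedge_tmul]

theorem lTensor_comp_wedge (φ : N →ₗ[Q] P) (T : M →ₗ[Q] Ω[Q⁄k] ⊗[Q] N) :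
    wedge (φ.lTensor (Ω[Q⁄k]) ∘ₗ T) = φ.lTensor (Forms k Q) ∘ₗ wedge T := by
  refine TensorProduct.ext' fun ω x => ?_
  simp only [wedge_tmul, LinearMap.comp_apply]
  induction T x with
  | zero => simp
  | tmul v y => simp
  | add a b ha hb => simp only [map_add, ha, hb]

variable (k M) in
/-- Right multiplication by the form `df` on `Ω^• ⊗ M`. -/
noncomputable def mulD (f : Q) : Module.End Q (Forms k Q ⊗[Q] M) :=
  (LinearMap.mulRight Q (dForm k f)).rTensor M

@[simp] theorem mulD_tmul (f : Q) (ω : Forms k Q) (x : M) :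
    mulD k M f (ω ⊗ₜ x) = (ω * dForm k f) ⊗ₜ x := by
  simp [mulD]

theorem mulD_lTensor (f : Q) (φ : M →ₗ[Q] N) :
    mulD k N f ∘ₗ φ.lTensor (Forms k Q) = φ.lTensor (Forms k Q) ∘ₗ mulD k M f := by
  refine TensorProduct.ext' fun ω x => ?_
  simp

/-- Both operators append a one-form on the right, so exchanging them costs the sign in df ∧ v = -v
∧ df. -/
theorem wedge_comp_mulD (f : Q) (T : M →ₗ[Q] Ω[Q⁄k] ⊗[Q] N) :
    wedge T ∘ₗ mulD k M f = -(mulD k N f ∘ₗ wedge T) := by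
  refine TensorProduct.ext' fun ω x => ?_
  simp only [LinearMap.comp_apply, LinearMap.neg_apply, mulD_tmul, wedge_tmul]
  induction T x with
  | zero => simp
  | tmul v y =>
    have := ExteriorAlgebra.ι_add_mul_swap (R := Q) (D k Q f) v
    simp only [LinearMap.rTensor_tmul, LinearMap.comp_apply, LinearMap.mulLeft_apply, mulD_tmul,
      ← TensorProduct.neg_tmul, dForm, mul_assoc, eq_neg_of_add_eq_zero_left this, mul_neg]
  | add a b ha hb => rw [map_add, ha, hb, map_add, map_add, neg_add]

variable (k M) in
/-- The image of `Ω^j ⊗ M` in `Ω^• ⊗ M`. -/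
noncomputable def formDegree (j : ℕ) : Submodule Q (Forms k Q ⊗[Q] M) :=
  LinearMap.range ((⋀[Q]^j (Ω[Q⁄k])).subtype.rTensor M)

theorem tmul_mem_formDegree {j : ℕ} {ω : Forms k Q} (h : ω ∈ ⋀[Q]^j (Ω[Q⁄k])) (x : M) :
    ω ⊗ₜ x ∈ formDegree k M j :=
  ⟨⟨ω, h⟩ ⊗ₜ x, by simp⟩

/-- The maps `Ω^• ⊗ M → Ω^• ⊗ N` that raise the form degree by `j`. -/
def RaisesDegree (j : ℕ) (T : Forms k Q ⊗[Q] M →ₗ[Q] Forms k Q ⊗[Q] N) : Prop :=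
  ∀ i, ∀ z ∈ formDegree k M i, T z ∈ formDegree k N (i + j)

theorem RaisesDegree.of_tmul {j : ℕ} {T : Forms k Q ⊗[Q] M →ₗ[Q] Forms k Q ⊗[Q] N}
    (h : ∀ i, ∀ ω ∈ ⋀[Q]^i (Ω[Q⁄k]), ∀ x : M, T (ω ⊗ₜ x) ∈ formDegree k N (i + j)) :
    RaisesDegree j T := by
  rintro i _ ⟨z, rfl⟩
  induction z with
  | zero => simp
  | tmul ω x => simpa using h i ω.1 ω.2 x
  | add a b ha hb => rw [map_add, map_add]; exact add_mem ha hb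

theorem RaisesDegree.comp {i j : ℕ} {S : Forms k Q ⊗[Q] N →ₗ[Q] Forms k Q ⊗[Q] P}
    {T : Forms k Q ⊗[Q] M →ₗ[Q] Forms k Q ⊗[Q] N} (hS : RaisesDegree i S)
    (hT : RaisesDegree j T) : RaisesDegree (j + i) (S ∘ₗ T) := fun l z hz => by
  rw [← add_assoc]
  exact hS _ _ (hT _ _ hz)

theorem RaisesDegree.add {j : ℕ} {S T : Forms k Q ⊗[Q] M →ₗ[Q] Forms k Q ⊗[Q] N}
    (hS : RaisesDegree j S) (hT : RaisesDegree j T) : RaisesDegree j (S + T) :=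
  fun i z hz => add_mem (hS i z hz) (hT i z hz)

theorem RaisesDegree.sub {j : ℕ} {S T : Forms k Q ⊗[Q] M →ₗ[Q] Forms k Q ⊗[Q] N}
    (hS : RaisesDegree j S) (hT : RaisesDegree j T) : RaisesDegree j (S - T) :=
  fun i z hz => sub_mem (hS i z hz) (hT i z hz)

theorem RaisesDegree.zsmul {j : ℕ} {T : Forms k Q ⊗[Q] M →ₗ[Q] Forms k Q ⊗[Q] N}
    (hT : RaisesDegree j T) (c : ℤ) : RaisesDegree j (c • T) :=
  fun i z hz => zsmul_mem (hT i z hz) c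

theorem raisesDegree_zero (j : ℕ) :
    RaisesDegree j (0 : Forms k Q ⊗[Q] M →ₗ[Q] Forms k Q ⊗[Q] N) :=
  fun _ _ _ => zero_mem _

theorem raisesDegree_lTensor (φ : M →ₗ[Q] N) : RaisesDegree 0 (φ.lTensor (Forms k Q)) :=
  .of_tmul fun i ω hω x => by simpa using tmul_mem_formDegree hω (φ x)

theorem raisesDegree_wedge (T : M →ₗ[Q] Ω[Q⁄k] ⊗[Q] N) : RaisesDegree 1 (wedge T) :=
  .of_tmul fun i ω hω x => by
    rw [wedge_tmul]
    induction T x with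
    | zero => simp
    | tmul v y =>
      refine tmul_mem_formDegree ?_ y
      change ω * ExteriorAlgebra.ι Q v ∈ LinearMap.range (ExteriorAlgebra.ι Q) ^ (i + 1)
      rw [pow_succ]
      exact Submodule.mul_mem_mul hω (LinearMap.mem_range_self _ v)
    | add a b ha hb => rw [map_add]; exact add_mem ha hb

theorem RaisesDegree.pow {T : Module.End Q (Forms k Q ⊗[Q] M)} (hT : RaisesDegree 1 T) (j : ℕ) :
    RaisesDegree j (T ^ j) := by
  induction j with
  | zero => exact fun i z hz => hz
  | succ j ih => rw [pow_succ']; exact hT.comp ih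

section

variable [Module.Finite Q M] [Module.Projective Q M] [Module.Finite Q N] [Module.Projective Q N]

/-- The trace in `Ω^•` of an endomorphism of `Ω^• ⊗ M`, which only depends on the restriction to
`1 ⊗ M`. -/
noncomputable def formTrace : Module.End Q (Forms k Q ⊗[Q] M) →ₗ[Q] Forms k Q :=
  traceWith Q M (Forms k Q) ∘ₗ LinearMap.lcomp Q _ (TensorProduct.mk Q (Forms k Q) M 1)

theorem formTrace_apply (T : Module.End Q (Forms k Q ⊗[Q] M)) :
    formTrace T = traceWith Q M (Forms k Q) (T ∘ₗ TensorProduct.mk Q (Forms k Q) M 1) := rfl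

/-- Since 1 ⊗ φ maps 1 ⊗ N to 1 ⊗ M, it is compatible with the restriction to 1 ⊗ M that defines the
trace. For general operators on Ω^• ⊗ M no such cyclicity is available. -/
theorem formTrace_comp_comm (φ : N →ₗ[Q] M) (T : Forms k Q ⊗[Q] M →ₗ[Q] Forms k Q ⊗[Q] N) :
    formTrace (φ.lTensor (Forms k Q) ∘ₗ T) = formTrace (T ∘ₗ φ.lTensor (Forms k Q)) := by
  rw [formTrace_apply, formTrace_apply, LinearMap.comp_assoc, traceWith_comp_comm]
  congr 1

theorem formTrace_mulD (f : Q) (T : Module.End Q (Forms k Q ⊗[Q] M)) :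
    formTrace (mulD k M f * T) = formTrace T * dForm k f := by
  rw [formTrace_apply, Module.End.mul_eq_comp, LinearMap.comp_assoc, mulD, traceWith_rTensor_comp]
  rfl

theorem formTrace_mem {j : ℕ} {T : Module.End Q (Forms k Q ⊗[Q] M)} (hT : RaisesDegree j T) :
    formTrace T ∈ ⋀[Q]^j (Ω[Q⁄k]) := by
  refine traceWith_mem _ _ fun x => ?_
  have := hT 0 (1 ⊗ₜ x) (tmul_mem_formDegree (by simp) x)
  rwa [zero_add] at this

end

end Forms

/-! ### Connections, the defect of a linear map, and horizontal maps. -/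

section Connections

open KaehlerDifferential

variable {k : Type v} {Q : Type u} [CommRing k] [CommRing Q] [Algebra k Q]
  {M N P M' N' : Type u} [AddCommGroup M] [Module Q M] [AddCommGroup N] [Module Q N]
  [AddCommGroup P] [Module Q P] [AddCommGroup M'] [Module Q M'] [AddCommGroup N'] [Module Q N']

namespace Connection

/-- The connection on a free module that annihilates the basis. -/
noncomputable def free (k : Type v) (Q : Type u) [CommRing k] [CommRing Q] [Algebra k Q]
    (ι : Type u) : Connection k Q (ι →₀ Q) where
  toFun := Finsupp.liftAddHom fun i =>
    ((TensorProduct.mk Q (Ω[Q⁄k]) (ι →₀ Q)).flip (Finsupp.single i 1)).toAddMonoidHom.comp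
      (D k Q).toLinearMap.toAddMonoidHom
  leibniz q x := by
    induction x using Finsupp.induction_linear with
    | zero => simp
    | add x y hx hy => simp only [smul_add, map_add, hx, hy, TensorProduct.tmul_add]; abel
    | single i r =>
      have h : Finsupp.single i r = r • Finsupp.single i (1 : Q) := by simp
      rw [Finsupp.smul_single, Finsupp.liftAddHom_apply_single, Finsupp.liftAddHom_apply_single, h,
        TensorProduct.tmul_smul, TensorProduct.smul_tmul']
      simp [TensorProduct.smul_tmul', add_comm]

/-- The connection induced on a direct summand. -/
noncomputable def retract (nabla : Connection k Q M) (i : N →ₗ[Q] M) (p : M →ₗ[Q] N)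
    (h : p ∘ₗ i = LinearMap.id) : Connection k Q N where
  toFun := (p.lTensor (Ω[Q⁄k])).toAddMonoidHom.comp (nabla.toFun.comp i.toAddMonoidHom)
  leibniz q x := by
    have : p (i x) = x := LinearMap.congr_fun h x
    simp [nabla.leibniz, this]

/-- A projective module is a direct summand of the free module on its own elements, and a connection
on the free module is projected to the summand. -/
theorem nonempty_of_projective (M : Type u) [AddCommGroup M] [Module Q M]
    [Module.Projective Q M] : Nonempty (Connection k Q M) := by
  obtain ⟨s, hs⟩ := Module.projective_lifting_property (Finsupp.linearCombination Q (id : M → M))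
    LinearMap.id (Finsupp.linearCombination_id_surjective Q M)
  exact ⟨(free k Q M).retract s _ hs⟩

/-- The linear map `∇ φ - (1 ⊗ φ) ∇` measuring the failure of `φ` to commute with connections. -/
noncomputable def defect (nabla : Connection k Q M) (nabla' : Connection k Q N) (φ : M →ₗ[Q] N) :
    M →ₗ[Q] Ω[Q⁄k] ⊗[Q] N where
  toFun x := nabla'.toFun (φ x) - φ.lTensor (Ω[Q⁄k]) (nabla.toFun x)
  map_add' x y := by simp only [map_add]; abel
  map_smul' q x := by
    simp only [map_smul, leibniz, map_add, LinearMap.lTensor_tmul, RingHom.id_apply, smul_sub]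
    abel

theorem defect_apply (nabla : Connection k Q M) (nabla' : Connection k Q N) (φ : M →ₗ[Q] N)
    (x : M) : nabla.defect nabla' φ x =
      nabla'.toFun (φ x) - φ.lTensor (Ω[Q⁄k]) (nabla.toFun x) := rfl

/-- Derivation property: an equation between composites of linear maps can be differentiated. The
relations between Atiyah operators, differentials and df below arise in this way. -/
theorem defect_comp (nabla : Connection k Q M) (nabla' : Connection k Q N)
    (nabla'' : Connection k Q P) (ψ : N →ₗ[Q] P) (φ : M →ₗ[Q] N) :
    nabla.defect nabla'' (ψ ∘ₗ φ) =
      nabla'.defect nabla'' ψ ∘ₗ φ + ψ.lTensor (Ω[Q⁄k]) ∘ₗ nabla.defect nabla' φ := by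
  ext x
  simp only [defect_apply, LinearMap.comp_apply, LinearMap.add_apply, LinearMap.lTensor_comp,
    map_sub]
  abel

theorem defect_add (nabla : Connection k Q M) (nabla' : Connection k Q N) (φ ψ : M →ₗ[Q] N) :
    nabla.defect nabla' (φ + ψ) = nabla.defect nabla' φ + nabla.defect nabla' ψ := by
  ext x
  simp only [defect_apply, LinearMap.add_apply, LinearMap.lTensor_add, map_add]
  abel

theorem defect_neg (nabla : Connection k Q M) (nabla' : Connection k Q N) (φ : M →ₗ[Q] N) :
    nabla.defect nabla' (-φ) = -nabla.defect nabla' φ := by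
  ext x
  simp only [defect_apply, LinearMap.neg_apply, LinearMap.lTensor_neg, map_neg]
  abel

/-- The Leibniz rule of the connection is what makes df appear: ∇(f x) - f ∇x = df ⊗ x. -/
theorem defect_smul_id (nabla : Connection k Q M) (f : Q) :
    nabla.defect nabla (f • LinearMap.id) = TensorProduct.mk Q _ M (D k Q f) := by
  ext x
  simp [defect_apply, nabla.leibniz]

theorem defect_id (nabla : Connection k Q M) : nabla.defect nabla LinearMap.id = 0 := by
  ext x
  simp [defect_apply]

/-- The extension of the defect of `φ` to a map `Ω^• ⊗ M → Ω^• ⊗ N`. -/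
noncomputable def wedgeDefect (nabla : Connection k Q M) (nabla' : Connection k Q N)
    (φ : M →ₗ[Q] N) : Forms k Q ⊗[Q] M →ₗ[Q] Forms k Q ⊗[Q] N :=
  wedge (nabla.defect nabla' φ)

theorem wedgeDefect_comp (nabla : Connection k Q M) (nabla' : Connection k Q N)
    (nabla'' : Connection k Q P) (ψ : N →ₗ[Q] P) (φ : M →ₗ[Q] N) :
    nabla.wedgeDefect nabla'' (ψ ∘ₗ φ) =
      nabla'.wedgeDefect nabla'' ψ ∘ₗ φ.lTensor (Forms k Q) +
        ψ.lTensor (Forms k Q) ∘ₗ nabla.wedgeDefect nabla' φ := by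
  rw [wedgeDefect, defect_comp nabla nabla' nabla'', wedge_add, wedge_comp, lTensor_comp_wedge]
  rfl

theorem wedgeDefect_add (nabla : Connection k Q M) (nabla' : Connection k Q N)
    (φ ψ : M →ₗ[Q] N) : nabla.wedgeDefect nabla' (φ + ψ) =
      nabla.wedgeDefect nabla' φ + nabla.wedgeDefect nabla' ψ := by
  rw [wedgeDefect, defect_add, wedge_add]; rfl

theorem wedgeDefect_neg (nabla : Connection k Q M) (nabla' : Connection k Q N)
    (φ : M →ₗ[Q] N) : nabla.wedgeDefect nabla' (-φ) = -nabla.wedgeDefect nabla' φ := by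
  rw [wedgeDefect, defect_neg, wedge_neg]; rfl

theorem wedgeDefect_smul_id (nabla : Connection k Q M) (f : Q) :
    nabla.wedgeDefect nabla (f • LinearMap.id) = mulD k M f := by
  refine TensorProduct.ext' fun ω x => ?_
  rw [wedgeDefect, wedge_tmul, defect_smul_id]
  simp [dForm]

theorem raisesDegree_wedgeDefect (nabla : Connection k Q M) (nabla' : Connection k Q N)
    (φ : M →ₗ[Q] N) : RaisesDegree 1 (nabla.wedgeDefect nabla' φ) :=
  raisesDegree_wedge _

theorem wedgeDefect_comp_mulD (nabla : Connection k Q M) (nabla' : Connection k Q N)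
    (φ : M →ₗ[Q] N) (f : Q) : nabla.wedgeDefect nabla' φ ∘ₗ mulD k M f =
      -(mulD k N f ∘ₗ nabla.wedgeDefect nabla' φ) :=
  wedge_comp_mulD f _

/-- A linear map commuting with the connections. -/
def IsHorizontal (nabla : Connection k Q M) (nabla' : Connection k Q N) (φ : M →ₗ[Q] N) : Prop :=
  nabla.defect nabla' φ = 0

section Horizontal

variable {nabla : Connection k Q M} {nabla' : Connection k Q N} {nabla'' : Connection k Q P}

theorem isHorizontal_iff {φ : M →ₗ[Q] N} : nabla.IsHorizontal nabla' φ ↔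
    ∀ x, nabla'.toFun (φ x) = φ.lTensor (Ω[Q⁄k]) (nabla.toFun x) := by
  simp only [IsHorizontal, LinearMap.ext_iff, defect_apply, LinearMap.zero_apply, sub_eq_zero]

theorem isHorizontal_id : nabla.IsHorizontal nabla LinearMap.id := nabla.defect_id

theorem IsHorizontal.comp {ψ : N →ₗ[Q] P} {φ : M →ₗ[Q] N}
    (hψ : nabla'.IsHorizontal nabla'' ψ) (hφ : nabla.IsHorizontal nabla' φ) :
    nabla.IsHorizontal nabla'' (ψ ∘ₗ φ) := by
  rw [IsHorizontal, defect_comp nabla nabla' nabla'', hψ, hφ]; simp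

theorem IsHorizontal.add {φ ψ : M →ₗ[Q] N} (hφ : nabla.IsHorizontal nabla' φ)
    (hψ : nabla.IsHorizontal nabla' ψ) : nabla.IsHorizontal nabla' (φ + ψ) := by
  rw [IsHorizontal, defect_add, hφ, hψ, add_zero]

theorem IsHorizontal.neg {φ : M →ₗ[Q] N} (hφ : nabla.IsHorizontal nabla' φ) :
    nabla.IsHorizontal nabla' (-φ) := by
  rw [IsHorizontal, defect_neg, hφ, neg_zero]

theorem IsHorizontal.wedgeDefect_eq_zero {φ : M →ₗ[Q] N} (hφ : nabla.IsHorizontal nabla' φ) :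
    nabla.wedgeDefect nabla' φ = 0 := by
  refine TensorProduct.ext' fun ω x => ?_
  rw [wedgeDefect, wedge_tmul, hφ]
  simp

/-- The direct sum of two connections. -/
noncomputable def prod (nabla : Connection k Q M) (nabla' : Connection k Q N) :
    Connection k Q (M × N) where
  toFun :=
    (((LinearMap.inl Q M N).lTensor (Ω[Q⁄k])).toAddMonoidHom.comp nabla.toFun).coprod
    (((LinearMap.inr Q M N).lTensor (Ω[Q⁄k])).toAddMonoidHom.comp nabla'.toFun)
  leibniz q x := by
    obtain ⟨x, y⟩ := x
    have : ((x, y) : M × N) = (x, 0) + (0, y) := by simp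
    simp only [AddMonoidHom.coprod_apply, Prod.smul_mk, AddMonoidHom.comp_apply, nabla.leibniz,
      nabla'.leibniz, map_add, LinearMap.toAddMonoidHom_coe, LinearMap.lTensor_tmul, map_smul]
    rw [this, TensorProduct.tmul_add, smul_add]
    simp only [LinearMap.inl_apply, LinearMap.inr_apply]
    abel

theorem prod_apply (nabla : Connection k Q M) (nabla' : Connection k Q N) (x : M × N) :
    (nabla.prod nabla').toFun x = (LinearMap.inl Q M N).lTensor (Ω[Q⁄k]) (nabla.toFun x.1) +
      (LinearMap.inr Q M N).lTensor (Ω[Q⁄k]) (nabla'.toFun x.2) := rfl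

variable (nabla nabla') in
theorem isHorizontal_inl : nabla.IsHorizontal (nabla.prod nabla') (LinearMap.inl Q M N) :=
  isHorizontal_iff.2 fun x => by simp [prod_apply]

variable (nabla nabla') in
theorem isHorizontal_inr : nabla'.IsHorizontal (nabla.prod nabla') (LinearMap.inr Q M N) :=
  isHorizontal_iff.2 fun x => by simp [prod_apply]

variable (nabla nabla') in
theorem isHorizontal_fst : (nabla.prod nabla').IsHorizontal nabla (LinearMap.fst Q M N) :=
  isHorizontal_iff.2 fun x => by
    rw [prod_apply, map_add, ← LinearMap.lTensor_comp_apply, ← LinearMap.lTensor_comp_apply]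
    simp

variable (nabla nabla') in
theorem isHorizontal_snd : (nabla.prod nabla').IsHorizontal nabla' (LinearMap.snd Q M N) :=
  isHorizontal_iff.2 fun x => by
    rw [prod_apply, map_add, ← LinearMap.lTensor_comp_apply, ← LinearMap.lTensor_comp_apply]
    simp

theorem IsHorizontal.prod {φ : M →ₗ[Q] N} {ψ : M →ₗ[Q] P} (hφ : nabla.IsHorizontal nabla' φ)
    (hψ : nabla.IsHorizontal nabla'' ψ) :
    nabla.IsHorizontal (nabla'.prod nabla'') (φ.prod ψ) := by
  have : φ.prod ψ = LinearMap.inl Q N P ∘ₗ φ + LinearMap.inr Q N P ∘ₗ ψ := by ext x <;> simp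
  rw [this]
  exact ((isHorizontal_inl nabla' nabla'').comp hφ).add ((isHorizontal_inr nabla' nabla'').comp hψ)

end Horizontal

/-- The additive map `x ⊗ y ↦ ∇ x ⊗ y + x ⊗ ∇ y`. -/
noncomputable def tensorFun (nabla : Connection k Q M) (nabla' : Connection k Q N) :
    M ⊗[Q] N →+ Ω[Q⁄k] ⊗[Q] (M ⊗[Q] N) :=
  TensorProduct.liftAddHom
    (AddMonoidHom.mk' (fun x => AddMonoidHom.mk' (fun y =>
      TensorProduct.assoc Q (Ω[Q⁄k]) M N (nabla.toFun x ⊗ₜ y) +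
        TensorProduct.leftComm Q M (Ω[Q⁄k]) N (x ⊗ₜ nabla'.toFun y))
      (fun y y' => by simp only [map_add, TensorProduct.tmul_add]; abel))
      (fun x x' => by
        ext y
        simp only [map_add, TensorProduct.add_tmul, AddMonoidHom.mk'_apply,
          AddMonoidHom.add_apply]
        abel))
    -- Neither summand is balanced over `Q`: moving `q` across the tensor sign moves the term dq ⊗ x
    -- ⊗ y from one summand to the other, and only the sum is unchanged.
    (fun q x y => by
      simp only [AddMonoidHom.mk'_apply, leibniz, TensorProduct.add_tmul, TensorProduct.tmul_add,
        map_add, TensorProduct.assoc_tmul, TensorProduct.leftComm_tmul, TensorProduct.tmul_smul,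
        TensorProduct.smul_tmul']
      rw [← TensorProduct.smul_tmul', ← TensorProduct.smul_tmul', map_smul, map_smul]
      abel)

theorem tensorFun_tmul (nabla : Connection k Q M) (nabla' : Connection k Q N) (x : M) (y : N) :
    nabla.tensorFun nabla' (x ⊗ₜ y) =
      TensorProduct.assoc Q (Ω[Q⁄k]) M N (nabla.toFun x ⊗ₜ y) +
        TensorProduct.leftComm Q M (Ω[Q⁄k]) N (x ⊗ₜ nabla'.toFun y) := rfl

/-- The connection `∇ ⊗ 1 + 1 ⊗ ∇` on a tensor product. -/
noncomputable def tensor (nabla : Connection k Q M) (nabla' : Connection k Q N) :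
    Connection k Q (M ⊗[Q] N) where
  toFun := nabla.tensorFun nabla'
  leibniz q z := by
    induction z with
    | zero => simp
    | add a b ha hb => simp only [smul_add, map_add, ha, hb, TensorProduct.tmul_add]; abel
    | tmul x y =>
      have h1 : (q • nabla.toFun x) ⊗ₜ[Q] y = q • (nabla.toFun x ⊗ₜ[Q] y) := rfl
      have h2 : (q • x) ⊗ₜ[Q] nabla'.toFun y = q • (x ⊗ₜ[Q] nabla'.toFun y) := rfl
      rw [TensorProduct.smul_tmul', tensorFun_tmul, tensorFun_tmul, leibniz,
        TensorProduct.add_tmul, map_add, TensorProduct.assoc_tmul, smul_add, h1, h2,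
        map_smul, map_smul, add_assoc]

theorem tensor_tmul (nabla : Connection k Q M) (nabla' : Connection k Q N) (x : M) (y : N) :
    (nabla.tensor nabla').toFun (x ⊗ₜ y) =
      TensorProduct.assoc Q (Ω[Q⁄k]) M N (nabla.toFun x ⊗ₜ y) +
        TensorProduct.leftComm Q M (Ω[Q⁄k]) N (x ⊗ₜ nabla'.toFun y) := rfl

theorem IsHorizontal.map {nabla : Connection k Q M} {nabla' : Connection k Q N}
    {mu : Connection k Q M'} {mu' : Connection k Q N'} {φ : M →ₗ[Q] M'} {ψ : N →ₗ[Q] N'}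
    (hφ : nabla.IsHorizontal mu φ) (hψ : nabla'.IsHorizontal mu' ψ) :
    (nabla.tensor nabla').IsHorizontal (mu.tensor mu') (TensorProduct.map φ ψ) := by
  rw [isHorizontal_iff] at hφ hψ ⊢
  intro z
  induction z with
  | zero => simp
  | add a b ha hb => simp only [map_add, ha, hb]
  | tmul x y =>
    rw [TensorProduct.map_tmul, tensor_tmul, tensor_tmul, hφ, hψ, map_add]
    congr 1
    · induction nabla.toFun x with
      | zero => simp
      | tmul v m => simp
      | add a b ha hb => simp only [map_add, TensorProduct.add_tmul, ha, hb]
    · induction nabla'.toFun y with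
      | zero => simp
      | tmul v m => simp
      | add a b ha hb => simp only [map_add, TensorProduct.tmul_add, ha, hb]

/-- φ ⊗ 1 does not touch the second factor, so the contributions of `nabla'` cancel and only the
defect of `φ` remains. -/
theorem wedgeDefect_rTensor (nabla : Connection k Q M) (nabla' : Connection k Q N)
    (φ : M →ₗ[Q] M) :
    (nabla.tensor nabla').wedgeDefect (nabla.tensor nabla') (φ.rTensor N) ∘ₗ
        (TensorProduct.assoc Q (Forms k Q) M N).toLinearMap =
      (TensorProduct.assoc Q (Forms k Q) M N).toLinearMap ∘ₗ
        (nabla.wedgeDefect nabla φ).rTensor N := by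
  have key (x : M) (y : N) : (nabla.tensor nabla').defect (nabla.tensor nabla') (φ.rTensor N)
      (x ⊗ₜ y) = TensorProduct.assoc Q (Ω[Q⁄k]) M N (nabla.defect nabla φ x ⊗ₜ y) := by
    rw [defect_apply, LinearMap.rTensor_tmul, tensor_tmul, tensor_tmul, defect_apply,
      TensorProduct.sub_tmul, map_add, map_sub]
    have h1 : (φ.rTensor N).lTensor (Ω[Q⁄k])
        (TensorProduct.assoc Q (Ω[Q⁄k]) M N (nabla.toFun x ⊗ₜ y)) =
        TensorProduct.assoc Q (Ω[Q⁄k]) M N (φ.lTensor (Ω[Q⁄k]) (nabla.toFun x) ⊗ₜ y) := by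
      induction nabla.toFun x with
      | zero => simp
      | tmul v m => simp
      | add a b ha hb => simp only [map_add, TensorProduct.add_tmul, ha, hb]
    have h2 : (φ.rTensor N).lTensor (Ω[Q⁄k])
        (TensorProduct.leftComm Q M (Ω[Q⁄k]) N (x ⊗ₜ nabla'.toFun y)) =
        TensorProduct.leftComm Q M (Ω[Q⁄k]) N (φ x ⊗ₜ nabla'.toFun y) := by
      induction nabla'.toFun y with
      | zero => simp
      | tmul v m => simp
      | add a b ha hb => simp only [map_add, TensorProduct.tmul_add, ha, hb]
    rw [h1, h2]
    abel
  refine TensorProduct.ext_threefold fun ω x y => ?_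
  simp only [LinearMap.comp_apply, LinearEquiv.coe_coe, TensorProduct.assoc_tmul, wedgeDefect,
    wedge_tmul, LinearMap.rTensor_tmul, key]
  induction nabla.defect nabla φ x with
  | zero => simp
  | tmul v m => simp
  | add a b ha hb => simp only [map_add, TensorProduct.add_tmul, ha, hb]

theorem wedgeDefect_lTensor (nabla : Connection k Q M) (nabla' : Connection k Q N)
    (φ : N →ₗ[Q] N) :
    (nabla.tensor nabla').wedgeDefect (nabla.tensor nabla') (φ.lTensor M) ∘ₗ
        (TensorProduct.leftComm Q M (Forms k Q) N).toLinearMap =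
      (TensorProduct.leftComm Q M (Forms k Q) N).toLinearMap ∘ₗ
        (nabla'.wedgeDefect nabla' φ).lTensor M := by
  have key (x : M) (y : N) : (nabla.tensor nabla').defect (nabla.tensor nabla') (φ.lTensor M)
      (x ⊗ₜ y) = TensorProduct.leftComm Q M (Ω[Q⁄k]) N (x ⊗ₜ nabla'.defect nabla' φ y) := by
    rw [defect_apply, LinearMap.lTensor_tmul, tensor_tmul, tensor_tmul, defect_apply,
      TensorProduct.tmul_sub, map_add, map_sub]
    have h1 : (φ.lTensor M).lTensor (Ω[Q⁄k])
        (TensorProduct.assoc Q (Ω[Q⁄k]) M N (nabla.toFun x ⊗ₜ y)) =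
        TensorProduct.assoc Q (Ω[Q⁄k]) M N (nabla.toFun x ⊗ₜ φ y) := by
      induction nabla.toFun x with
      | zero => simp
      | tmul v m => simp
      | add a b ha hb => simp only [map_add, TensorProduct.add_tmul, ha, hb]
    have h2 : (φ.lTensor M).lTensor (Ω[Q⁄k])
        (TensorProduct.leftComm Q M (Ω[Q⁄k]) N (x ⊗ₜ nabla'.toFun y)) =
        TensorProduct.leftComm Q M (Ω[Q⁄k]) N (x ⊗ₜ φ.lTensor (Ω[Q⁄k]) (nabla'.toFun y)) := by
      induction nabla'.toFun y with
      | zero => simp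
      | tmul v m => simp
      | add a b ha hb => simp only [map_add, TensorProduct.tmul_add, ha, hb]
    rw [h1, h2]
    abel
  refine TensorProduct.ext' fun x z => ?_
  induction z with
  | zero => simp
  | add a b ha hb => simp only [map_add, TensorProduct.tmul_add, ha, hb]
  | tmul ω y =>
    simp only [LinearMap.comp_apply, LinearEquiv.coe_coe, TensorProduct.leftComm_tmul,
      wedgeDefect, wedge_tmul, LinearMap.lTensor_tmul, key]
    induction nabla'.defect nabla' φ y with
    | zero => simp
    | tmul v m => simp
    | add a b ha hb => simp only [map_add, TensorProduct.tmul_add, ha, hb]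

end Connection

end Connections

set_option maxSynthPendingDepth 5

/-! ### Powers of anticommuting elements of a ring. -/

section Ring

variable {R : Type*} [Ring R] {D A F : R}

theorem pow_mul_of_anticomm (h : A * F = -(F * A)) (j : ℕ) :
    A ^ j * F = (-1) ^ j * (F * A ^ j) := by
  induction j with
  | zero => simp
  | succ j ih =>
    rw [pow_succ', mul_assoc, ih, pow_succ' (-1 : R)]
    rcases neg_one_pow_eq_or R j with e | e <;> rw [e]
    · linear_combination (norm := noncomm_ring) h * A ^ j
    · linear_combination (norm := noncomm_ring) -h * A ^ j

theorem mul_pow_of_anticomm (h : F * A = -(A * F)) (j : ℕ) :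
    F * A ^ j = (-1) ^ j * (A ^ j * F) := by
  rw [pow_mul_of_anticomm (neg_eq_iff_eq_neg.1 h.symm) j, ← mul_assoc, ← pow_add,
    Even.neg_one_pow ⟨j, rfl⟩, one_mul]

/-- Moving D through A^(j+1) replaces each of the j + 1 factors A once by F. The sign of D passing
the earlier factors cancels the sign of moving F to the front, so the contributions add up to j + 1
instead of alternating. -/
theorem mul_pow_succ_of_anticomm (h1 : D * A + A * D = F) (h2 : A * F = -(F * A)) (j : ℕ) :
    D * A ^ (j + 1) = (-1) ^ (j + 1) * (A ^ (j + 1) * D) + (j + 1) • (F * A ^ j) := by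
  induction j with
  | zero => simp [← h1]
  | succ j ih =>
    have h3 := pow_mul_of_anticomm h2 (j + 1)
    have h4 : A ^ (j + 1 + 1) * D = A ^ (j + 1) * F - A ^ (j + 1) * D * A := by
      rw [← h1, pow_succ]; noncomm_ring
    rw [pow_succ A (j + 1), ← mul_assoc, ih, ← pow_succ, h4, h3, pow_succ (-1 : R) (j + 1)]
    rcases neg_one_pow_eq_or R (j + 1) with e | e <;> rw [e, succ_nsmul _ (j + 1), add_mul,
      smul_mul_assoc, mul_assoc F, ← pow_succ] <;> noncomm_ring

end Ring

/-! ### Comparison of the powers of two Atiyah operators along a map. -/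

section Intertwining

open KaehlerDifferential

variable {k : Type v} {Q : Type u} [CommRing k] [CommRing Q] [Algebra k Q]
  {M N : Type u} [AddCommGroup M] [Module Q M] [AddCommGroup N] [Module Q N]

/-- Induction on A'^(j+2) α - α A^(j+2) = A'(A'^(j+1) α - α A^(j+1)) + (A'α - αA) A^(j+1). Pushing
D' to the left and D to the right keeps the shape of the right-hand side and releases multiples of
F'. Only even j + 1 is used later: the terms with Z then form an anticommutator, which the
supertrace kills. -/
theorem exists_intertwining {D A F : Module.End Q (Forms k Q ⊗[Q] M)}
    {D' A' F' : Module.End Q (Forms k Q ⊗[Q] N)} {α θ : Forms k Q ⊗[Q] M →ₗ[Q] Forms k Q ⊗[Q] N}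
    (h1 : D * A + A * D = F) (h2 : A * F = -(F * A)) (h1' : D' * A' + A' * D' = F')
    (h2' : A' * F' = -(F' * A')) (hα : A' ∘ₗ α - α ∘ₗ A = θ ∘ₗ D - D' ∘ₗ θ)
    (hθ : θ ∘ₗ F = -(F' ∘ₗ θ)) (degA : RaisesDegree 1 A) (degA' : RaisesDegree 1 A')
    (degθ : RaisesDegree 1 θ) (j : ℕ) :
    ∃ Z Y : Forms k Q ⊗[Q] M →ₗ[Q] Forms k Q ⊗[Q] N, RaisesDegree (j + 1) Z ∧ RaisesDegree j Y ∧
      (A' ^ (j + 1)) ∘ₗ α - α ∘ₗ (A ^ (j + 1)) =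
        Z ∘ₗ D + (-1 : ℤ) ^ (j + 1) • (D' ∘ₗ Z) + F' ∘ₗ Y := by
  induction j with
  | zero =>
    refine ⟨θ, 0, degθ, raisesDegree_zero 0, ?_⟩
    simp [hα]
    exact sub_eq_add_neg _ _
  | succ j ih =>
    obtain ⟨Z, Y, hZ, hY, e⟩ := ih
    -- Z collects the terms ending in D. Y collects what is released by A'D' = F' - D'A', by A'F' =
    -- -F'A' applied to the old Y, and by D passing A^(j+1).
    refine ⟨A' ∘ₗ Z + (-1 : ℤ) ^ (j + 1) • (θ ∘ₗ A ^ (j + 1)),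
      (-1 : ℤ) ^ (j + 1) • Z - A' ∘ₗ Y - ((j + 1 : ℕ) : ℤ) • (θ ∘ₗ A ^ j),
      (degA'.comp hZ).add ((degθ.comp (degA.pow _)).zsmul _),
      ((hZ.zsmul _).sub (degA'.comp hY)).sub ((degθ.comp (degA.pow _)).zsmul _), ?_⟩
    refine LinearMap.ext fun z => ?_
    have e1 := LinearMap.congr_fun e z
    have e2 := LinearMap.congr_fun hα ((A ^ (j + 1)) z)
    have e3 := LinearMap.congr_fun (mul_pow_succ_of_anticomm h1 h2 j) z
    have e4 := LinearMap.congr_fun hθ ((A ^ j) z)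
    have e5 := LinearMap.congr_fun h1' (Z z)
    have e6 := LinearMap.congr_fun h2' (Y z)
    rw [pow_succ' A' (j + 1), pow_succ' A (j + 1), pow_succ (-1 : ℤ) (j + 1)]
    have hε : ((-1) ^ (j + 1) : Module.End Q (Forms k Q ⊗[Q] M)) =
        (((-1 : ℤ) ^ (j + 1) : ℤ) : Module.End Q (Forms k Q ⊗[Q] M)) := by push_cast; rfl
    rw [hε, ← zsmul_eq_mul, ← natCast_zsmul] at e3
    generalize hm : ((j + 1 : ℕ) : ℤ) = m at *
    simp only [LinearMap.comp_apply, LinearMap.sub_apply, LinearMap.add_apply,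
      LinearMap.smul_apply, LinearMap.neg_apply, Module.End.mul_apply, map_sub, map_add,
      map_zsmul] at e1 e2 e3 e4 e5 e6 ⊢
    have e1' := sub_eq_iff_eq_add.1 e1
    have e2' := sub_eq_iff_eq_add.1 e2
    have e5' := eq_sub_of_add_eq' e5
    rw [e1']
    simp only [map_add, map_zsmul]
    rw [e2', e3, e5', e6]
    simp only [map_add, map_zsmul]
    rw [e4]
    rcases neg_one_pow_eq_or ℤ (j + 1) with e | e <;> rw [e] <;> module

end Intertwining

/-! ### Supertraces of powers of the Atiyah class, and the cycle property. -/

section Supertrace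

open KaehlerDifferential

variable {k : Type v} {Q : Type u} [CommRing k] [CommRing Q] [Algebra k Q] {f : Q}

/-- The involution of `E0 ⊕ E1` that is `1` on `E0` and `-1` on `E1`. -/
def parity (E : MatrixFactorization Q f) : E.M0 × E.M1 →ₗ[Q] E.M0 × E.M1 :=
  LinearMap.prodMap LinearMap.id (-LinearMap.id)

theorem parity_comp_parity (E : MatrixFactorization Q f) :
    E.parity ∘ₗ E.parity = LinearMap.id := by
  ext <;> simp [parity]

theorem parity_comp_totalD (E : MatrixFactorization Q f) :
    E.parity ∘ₗ E.totalD = -(E.totalD ∘ₗ E.parity) := by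
  ext <;> simp [parity, totalD]

theorem totalD_comp_totalD (E : MatrixFactorization Q f) :
    E.totalD ∘ₗ E.totalD = f • LinearMap.id := by
  ext <;> simp [totalD]

variable (k) in
/-- The involution of `Ω^• ⊗ E` induced by the parity of `E`. -/
noncomputable def extParity (E : MatrixFactorization Q f) :
    Module.End Q (Forms k Q ⊗[Q] (E.M0 × E.M1)) :=
  E.parity.lTensor (Forms k Q)

variable (k) in
/-- The differential of `E` extended to `Ω^• ⊗ E`. -/
noncomputable def extD (E : MatrixFactorization Q f) :
    Module.End Q (Forms k Q ⊗[Q] (E.M0 × E.M1)) :=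
  E.totalD.lTensor (Forms k Q)

variable (E : MatrixFactorization Q f)

theorem extParity_mul_self : E.extParity k * E.extParity k = 1 := by
  rw [extParity, Module.End.mul_eq_comp, ← LinearMap.lTensor_comp, parity_comp_parity,
    LinearMap.lTensor_id]; rfl

theorem extParity_mul_extD : E.extParity k * E.extD k = -(E.extD k * E.extParity k) := by
  rw [extParity, extD, Module.End.mul_eq_comp, ← LinearMap.lTensor_comp, parity_comp_totalD,
    LinearMap.lTensor_neg, LinearMap.lTensor_comp]; rfl

theorem extParity_mul_mulD (g : Q) :
    E.extParity k * mulD k (E.M0 × E.M1) g = mulD k (E.M0 × E.M1) g * E.extParity k :=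
  (mulD_lTensor g E.parity).symm

variable (nabla0 : Connection k Q E.M0) (nabla1 : Connection k Q E.M1)

/-- The map `ω ⊗ x ↦ ω ∧ At(x)`, as an element of the ring of endomorphisms of `Ω^• ⊗ E`. -/
noncomputable def extAtiyah : Module.End Q (Forms k Q ⊗[Q] (E.M0 × E.M1)) :=
  E.wedgeAtiyah nabla0 nabla1

/-- The Atiyah class is the defect of d for the direct sum connection, which makes the calculus of
defects applicable. -/
theorem extAtiyah_eq : E.extAtiyah nabla0 nabla1 =
    (nabla0.prod nabla1).wedgeDefect (nabla0.prod nabla1) E.totalD := rfl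

theorem isHorizontal_parity :
    (nabla0.prod nabla1).IsHorizontal (nabla0.prod nabla1) E.parity :=
  (Connection.isHorizontal_fst nabla0 nabla1).prod (Connection.isHorizontal_snd nabla0 nabla1).neg

/-- The equation d ∘ d = f, differentiated by the derivation property of the defect. -/
theorem extD_mul_extAtiyah :
    E.extD k * E.extAtiyah nabla0 nabla1 + E.extAtiyah nabla0 nabla1 * E.extD k =
      mulD k (E.M0 × E.M1) f := by
  rw [← (nabla0.prod nabla1).wedgeDefect_smul_id, ← totalD_comp_totalD,
    Connection.wedgeDefect_comp _ (nabla0.prod nabla1), add_comm]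
  rfl

theorem extAtiyah_mul_mulD (g : Q) :
    E.extAtiyah nabla0 nabla1 * mulD k (E.M0 × E.M1) g =
      -(mulD k (E.M0 × E.M1) g * E.extAtiyah nabla0 nabla1) :=
  wedge_comp_mulD g _

/-- The parity is horizontal for a direct sum connection, so differentiating Γd = -dΓ leaves only
the terms with the defect of d. -/
theorem extParity_mul_extAtiyah :
    E.extParity k * E.extAtiyah nabla0 nabla1 =
      -(E.extAtiyah nabla0 nabla1 * E.extParity k) := by
  have h := (E.isHorizontal_parity nabla0 nabla1).wedgeDefect_eq_zero
  have e := congrArg ((nabla0.prod nabla1).wedgeDefect (nabla0.prod nabla1))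
    E.parity_comp_totalD
  rw [Connection.wedgeDefect_neg, Connection.wedgeDefect_comp _ (nabla0.prod nabla1),
    Connection.wedgeDefect_comp _ (nabla0.prod nabla1), h, LinearMap.zero_comp,
    LinearMap.comp_zero, zero_add, add_zero] at e
  exact e

theorem raisesDegree_extAtiyah : RaisesDegree 1 (E.extAtiyah nabla0 nabla1) :=
  raisesDegree_wedge _

/-- The supertrace of the `j`-th power of the Atiyah class. -/
noncomputable def strAtiyah (j : ℕ) : Forms k Q :=
  formTrace (E.extParity k * E.extAtiyah nabla0 nabla1 ^ j)

theorem atiyahPow_eq (j : ℕ) : E.atiyahPow nabla0 nabla1 j =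
    (E.extAtiyah nabla0 nabla1 ^ j) ∘ₗ TensorProduct.mk Q (Forms k Q) (E.M0 × E.M1) 1 := by
  induction j with
  | zero => rfl
  | succ j ih => rw [atiyahPow, ih, pow_succ']; rfl

/-- By cyclicity the trace of each diagonal block is the trace of T composed with the corresponding
idempotent of E0 ⊕ E1, and the difference of the two idempotents is the parity. -/
theorem supertrace_eq (T : E.M0 × E.M1 →ₗ[Q] Forms k Q ⊗[Q] (E.M0 × E.M1)) :
    E.supertrace T = traceWith Q (E.M0 × E.M1) (Forms k Q) (E.extParity k ∘ₗ T) := by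
  have h1 : (LinearMap.inl Q E.M0 E.M1 ∘ₗ LinearMap.fst Q E.M0 E.M1 -
      LinearMap.inr Q E.M0 E.M1 ∘ₗ LinearMap.snd Q E.M0 E.M1) = E.parity := by
    ext <;> simp [parity]
  rw [extParity, ← h1, LinearMap.lTensor_sub, LinearMap.sub_comp, LinearMap.lTensor_comp,
    LinearMap.lTensor_comp, map_sub (traceWith Q _ _), LinearMap.comp_assoc, LinearMap.comp_assoc,
    traceWith_comp_comm, traceWith_comp_comm]
  rfl

theorem supertrace_atiyahPow (j : ℕ) :
    E.supertrace (E.atiyahPow nabla0 nabla1 j) = E.strAtiyah nabla0 nabla1 j := by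
  rw [supertrace_eq, atiyahPow_eq]; rfl

theorem strAtiyah_mem (j : ℕ) : E.strAtiyah nabla0 nabla1 j ∈ ⋀[Q]^j (Ω[Q⁄k]) :=
  formTrace_mem (j := j)
    ((raisesDegree_lTensor E.parity).comp ((E.raisesDegree_extAtiyah nabla0 nabla1).pow j))

theorem extParity_mul_pow (j : ℕ) : E.extParity k * E.extAtiyah nabla0 nabla1 ^ j =
    (-1) ^ j * (E.extAtiyah nabla0 nabla1 ^ j * E.extParity k) :=
  mul_pow_of_anticomm (E.extParity_mul_extAtiyah nabla0 nabla1) j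

theorem formTrace_extParity_mul (T : Module.End Q (Forms k Q ⊗[Q] (E.M0 × E.M1))) :
    formTrace (E.extParity k * T) = formTrace (T * E.extParity k) :=
  formTrace_comp_comm E.parity T

theorem formTrace_extD_mul (T : Module.End Q (Forms k Q ⊗[Q] (E.M0 × E.M1))) :
    formTrace (E.extD k * T) = formTrace (T * E.extD k) :=
  formTrace_comp_comm E.totalD T

/-- The supertrace of `[D, T]`. -/
theorem formTrace_extParity_mul_extD_mul (T : Module.End Q (Forms k Q ⊗[Q] (E.M0 × E.M1))) :
    formTrace (E.extParity k * (E.extD k * T)) = -formTrace (E.extParity k * (T * E.extD k)) := by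
  rw [← mul_assoc, extParity_mul_extD, neg_mul, map_neg, mul_assoc,
    formTrace_extD_mul, mul_assoc]

theorem formTrace_extParity_mul_mulD_mul (g : Q)
    (T : Module.End Q (Forms k Q ⊗[Q] (E.M0 × E.M1))) :
    formTrace (E.extParity k * (mulD k _ g * T)) = formTrace (E.extParity k * T) * dForm k g := by
  rw [← mul_assoc, extParity_mul_mulD, mul_assoc, formTrace_mulD]

theorem extD_mul_pow_of_even {j : ℕ} (hj : Even (j + 1)) :
    E.extD k * E.extAtiyah nabla0 nabla1 ^ (j + 1) =
      E.extAtiyah nabla0 nabla1 ^ (j + 1) * E.extD k +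
        (j + 1) • (mulD k _ f * E.extAtiyah nabla0 nabla1 ^ j) := by
  rw [mul_pow_succ_of_anticomm (E.extD_mul_extAtiyah nabla0 nabla1)
    (E.extAtiyah_mul_mulD nabla0 nabla1 f), hj.neg_one_pow, one_mul]

variable (k) in
theorem eq_zero_of_nsmul_eq_zero [Algebra ℚ k] {X : Type*} [AddCommGroup X] [Module Q X] {m : ℕ}
    (hm : m ≠ 0) {x : X} (h : m • x = 0) : x = 0 := by
  have : algebraMap k Q (algebraMap ℚ k (1 / (m : ℚ))) * (m : Q) = 1 := by
    rw [← map_natCast (algebraMap k Q), ← map_natCast (algebraMap ℚ k), ← map_mul, ← map_mul,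
      one_div_mul_cancel (Nat.cast_ne_zero.2 hm), map_one, map_one]
  rw [← one_smul Q x, ← this, mul_smul, Nat.cast_smul_eq_nsmul, h, smul_zero]

/-- For odd j anticommutation gives tr(Γ A^j) = -tr(A^j Γ), while cyclicity gives tr(Γ A^j) = tr(A^j
Γ). -/
theorem strAtiyah_odd [Algebra ℚ k] {j : ℕ} (hj : Odd j) : E.strAtiyah nabla0 nabla1 j = 0 := by
  refine eq_zero_of_nsmul_eq_zero k (Q := Q) two_ne_zero ?_
  rw [two_smul]
  nth_rewrite 1 [strAtiyah]
  rw [extParity_mul_pow, hj.neg_one_pow, neg_one_mul, map_neg, ← formTrace_extParity_mul]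
  exact neg_add_cancel _

theorem strAtiyah_mem_even [Algebra ℚ k] (j : ℕ) :
    E.strAtiyah nabla0 nabla1 j ∈ formsIn k Q {i | Even i} := by
  rcases Nat.even_or_odd j with hj | hj
  · exact le_iSup₂_of_le (f := fun i (_ : i ∈ {i | Even i}) => ⋀[Q]^i (Ω[Q⁄k])) j hj le_rfl
      (E.strAtiyah_mem nabla0 nabla1 j)
  · rw [E.strAtiyah_odd nabla0 nabla1 hj]; exact zero_mem _

/-- For even j, take supertraces in D A^(j+1) = -A^(j+1) D + (j+1) F A^j: the two terms with D
cancel because str(DT) = -str(TD). Each term of the Chern form is thus a cycle by itself, without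
truncation. -/
theorem strAtiyah_mul_dForm [Algebra ℚ k] (j : ℕ) :
    E.strAtiyah nabla0 nabla1 j * dForm k f = 0 := by
  rcases Nat.even_or_odd j with hj | hj
  · have h := mul_pow_succ_of_anticomm (E.extD_mul_extAtiyah nabla0 nabla1)
      (E.extAtiyah_mul_mulD nabla0 nabla1 f) j
    rw [hj.add_one.neg_one_pow, neg_one_mul] at h
    have h2 := congrArg (fun T => formTrace (E.extParity k * T)) h
    simp only [mul_add, map_add, mul_neg, map_neg, mul_smul_comm, map_nsmul,
      formTrace_extParity_mul_extD_mul, formTrace_extParity_mul_mulD_mul] at h2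
    exact eq_zero_of_nsmul_eq_zero k (Q := Q) (Nat.succ_ne_zero j) (left_eq_add.1 h2)
  · rw [E.strAtiyah_odd nabla0 nabla1 hj, zero_mul]

theorem strAtiyah_mem_cycles [Algebra ℚ k] (n j : ℕ) :
    E.strAtiyah nabla0 nabla1 j ∈ cycles k n f := by
  refine ⟨E.strAtiyah_mem_even nabla0 nabla1 j, ?_⟩
  change dForm k f * _ ∈ formsIn k Q {i | n < i}
  rw [even_mul_comm (E.strAtiyah_mem_even nabla0 nabla1 j), E.strAtiyah_mul_dForm]
  exact zero_mem _

theorem chernForm_eq [Algebra ℚ k] (n : ℕ) : chernForm n E nabla0 nabla1 =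
    ∑ j ∈ Finset.range (n + 1), algebraMap k Q (algebraMap ℚ k (1 / (j.factorial : ℚ))) •
      E.strAtiyah nabla0 nabla1 j := by
  simp only [chernForm, supertrace_atiyahPow]

theorem chernForm_mem_cycles [Algebra ℚ k] (n : ℕ) :
    chernForm n E nabla0 nabla1 ∈ cycles k n f := by
  rw [chernForm_eq]
  exact sum_mem fun j _ => Submodule.smul_mem _ _ (E.strAtiyah_mem_cycles nabla0 nabla1 n j)

/-- Traces produce df on the right, whereas `boundaries` has it on the left; for odd forms the
exchange costs only a sign. -/
theorem mul_dForm_mem_boundaries (n : ℕ) {j : ℕ} (hj : Odd j) {z : Forms k Q}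
    (hz : z ∈ ⋀[Q]^j (Ω[Q⁄k])) : z * dForm k f ∈ boundaries k n f := by
  have h : z ∈ formsIn k Q {i | Odd i} :=
    le_iSup₂_of_le (f := fun i (_ : i ∈ {i | Odd i}) => ⋀[Q]^i (Ω[Q⁄k])) j hj le_rfl hz
  rw [show z * dForm k f = -(dForm k f * z) from (neg_eq_iff_eq_neg.2 (ι_mul_odd (D k Q f) h)).symm]
  exact neg_mem (Submodule.mem_sup_left ⟨z, h, rfl⟩)

end Supertrace

/-! ### Homotopy invariance and independence of the connections. -/

section Invariance

open KaehlerDifferential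

variable {k : Type v} {Q : Type u} [CommRing k] [CommRing Q] [Algebra k Q] {f : Q}
  {E E' : MatrixFactorization Q f}

/-- An endomorphism homotopic to the identity does not change the supertrace of an even power of
the Atiyah class, up to boundaries. -/
theorem formTrace_homotopic_id (nabla0 : Connection k Q E.M0) (nabla1 : Connection k Q E.M1)
    (n : ℕ) {j : ℕ} (hj : Even j) {u h : E.M0 × E.M1 →ₗ[Q] E.M0 × E.M1}
    (hu : E.totalD ∘ₗ h + h ∘ₗ E.totalD = u - LinearMap.id) :
    formTrace (E.extParity k * (E.extAtiyah nabla0 nabla1 ^ j * u.lTensor (Forms k Q))) -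
      E.strAtiyah nabla0 nabla1 j ∈ boundaries k n f := by
  obtain ⟨H, hH⟩ : ∃ H : Module.End Q (Forms k Q ⊗[Q] (E.M0 × E.M1)), H = h.lTensor (Forms k Q) := ⟨_, rfl⟩
  have hu' : u.lTensor (Forms k Q) = 1 + (E.extD k * H + H * E.extD k) := by
    have : u = LinearMap.id + (E.totalD ∘ₗ h + h ∘ₗ E.totalD) := by rw [hu]; abel
    rw [this, LinearMap.lTensor_add, LinearMap.lTensor_add, LinearMap.lTensor_comp,
      LinearMap.lTensor_comp, LinearMap.lTensor_id, hH]
    rfl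
  -- Under the supertrace the last D in A^j H D moves to the front with a sign, so A^j (DH + HD)
  -- contributes str((A^j D - D A^j) H).
  rw [hu', mul_add, mul_one, mul_add, mul_add, map_add, ← strAtiyah, add_sub_cancel_left, mul_add,
    map_add, ← mul_assoc _ H, ← neg_neg (formTrace (E.extParity k * (_ * H * _))),
    ← formTrace_extParity_mul_extD_mul, ← sub_eq_add_neg, ← map_sub, ← mul_sub, ← mul_assoc,
    ← mul_assoc (E.extD k), ← sub_mul]
  cases j with
  | zero => simp
  | succ j =>
    -- For the even exponent j + 1 this commutator is -(j+1) F A^j. What remains is a multiple of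
    -- str(A^j H) ∧ df, with A^j H of odd degree j.
    rw [extD_mul_pow_of_even _ _ _ hj, sub_add_cancel_left, neg_mul, mul_neg, map_neg,
      smul_mul_assoc, mul_smul_comm, map_nsmul, mul_assoc, formTrace_extParity_mul_mulD_mul]
    refine neg_mem (nsmul_mem (mul_dForm_mem_boundaries n (by simpa [Nat.even_add_one] using hj)
      (formTrace_mem ?_)) _)
    have := (raisesDegree_lTensor (k := k) E.parity).comp
      (((E.raisesDegree_extAtiyah nabla0 nabla1).pow j).comp (raisesDegree_lTensor h))
    rw [zero_add, add_zero] at this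
    rw [hH]
    exact this

/-- The map of total modules underlying a strict morphism. -/
def Hom.total (α : Hom E E') : E.M0 × E.M1 →ₗ[Q] E'.M0 × E'.M1 :=
  LinearMap.prodMap α.φ0 α.φ1

theorem Hom.totalD_comp_total (α : Hom E E') : E'.totalD ∘ₗ α.total = α.total ∘ₗ E.totalD := by
  ext <;> simp [total, totalD, Hom.d0_apply, Hom.d1_apply]

theorem Hom.parity_comp_total (α : Hom E E') : E'.parity ∘ₗ α.total = α.total ∘ₗ E.parity := by
  ext <;> simp [total, parity]

/-- The Atiyah classes of two matrix factorizations, composed with the two composites of a pair of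
opposite morphisms, have the same supertraces up to boundaries. -/
theorem formTrace_comp_sub_mem (α : Hom E E') (β : Hom E' E) (nabla0 : Connection k Q E.M0)
    (nabla1 : Connection k Q E.M1) (nabla0' : Connection k Q E'.M0)
    (nabla1' : Connection k Q E'.M1) (n : ℕ) {j : ℕ} (hj : Even j) :
    formTrace (E'.extParity k *
        (E'.extAtiyah nabla0' nabla1' ^ j * (α.comp β).total.lTensor (Forms k Q))) -
      formTrace (E.extParity k *
        (E.extAtiyah nabla0 nabla1 ^ j * (β.comp α).total.lTensor (Forms k Q))) ∈
      boundaries k n f := by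
  set A := E.extAtiyah nabla0 nabla1
  set A' := E'.extAtiyah nabla0' nabla1'
  set a := α.total.lTensor (Forms k Q)
  set b := β.total.lTensor (Forms k Q)
  have hab : (α.comp β).total.lTensor (Forms k Q) = a ∘ₗ b := by
    rw [← LinearMap.lTensor_comp]; rfl
  have hba : (β.comp α).total.lTensor (Forms k Q) = b ∘ₗ a := by
    rw [← LinearMap.lTensor_comp]; rfl
  have hb : E.extParity k ∘ₗ b = b ∘ₗ E'.extParity k := by
    rw [extParity, extParity, ← LinearMap.lTensor_comp, ← LinearMap.lTensor_comp,
      β.parity_comp_total]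
  have ha : E'.extParity k ∘ₗ a = a ∘ₗ E.extParity k := by
    rw [extParity, extParity, ← LinearMap.lTensor_comp, ← LinearMap.lTensor_comp,
      α.parity_comp_total]
  have hDb : E.extD k ∘ₗ b = b ∘ₗ E'.extD k := by
    rw [extD, extD, ← LinearMap.lTensor_comp, ← LinearMap.lTensor_comp, β.totalD_comp_total]
  -- Cyclicity replaces A^j b a on the side of `E` by a A^j b on the side of `E'`, so that both
  -- supertraces concern endomorphisms of Ω^• ⊗ E'.
  have h2 : formTrace (E.extParity k * (A ^ j * (b ∘ₗ a : Module.End Q _))) =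
      formTrace (E'.extParity k * ((a ∘ₗ (A ^ j)) ∘ₗ b : Module.End Q _)) := by
    have := formTrace_comp_comm α.total (E.extParity k ∘ₗ (A ^ j) ∘ₗ b)
    rw [← LinearMap.comp_assoc, ← ha] at this
    exact this.symm
  rw [hab, hba, h2, ← map_sub, ← mul_sub]
  have h3 : A' ^ j * (a ∘ₗ b : Module.End Q _) - ((a ∘ₗ (A ^ j)) ∘ₗ b : Module.End Q _) = ((A' ^ j) ∘ₗ a - a ∘ₗ (A ^ j)) ∘ₗ b := by
    rw [LinearMap.sub_comp]; rfl
  rw [h3]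
  cases j with
  | zero =>
    have : (A' ^ 0) ∘ₗ a - a ∘ₗ (A ^ 0) = 0 := LinearMap.ext fun z => by simp
    rw [this, LinearMap.zero_comp, mul_zero, map_zero]
    exact zero_mem _
  | succ j =>
    set θ := (nabla0.prod nabla1).wedgeDefect (nabla0'.prod nabla1') α.total
    -- This is the equation d'α = αd, differentiated; θ is the defect of α for the two unrelated
    -- connections.
    have hα : A' ∘ₗ a - a ∘ₗ A = θ ∘ₗ E.extD k - E'.extD k ∘ₗ θ := by
      have := congrArg ((nabla0.prod nabla1).wedgeDefect (nabla0'.prod nabla1'))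
        α.totalD_comp_total
      rw [Connection.wedgeDefect_comp _ (nabla0'.prod nabla1'),
        Connection.wedgeDefect_comp _ (nabla0.prod nabla1)] at this
      rw [sub_eq_sub_iff_add_eq_add]
      exact this
    obtain ⟨Z, Y, -, hY, e⟩ := exists_intertwining (E.extD_mul_extAtiyah nabla0 nabla1)
      (E.extAtiyah_mul_mulD nabla0 nabla1 f) (E'.extD_mul_extAtiyah nabla0' nabla1')
      (E'.extAtiyah_mul_mulD nabla0' nabla1' f) hα
      (Connection.wedgeDefect_comp_mulD _ _ _ f) (E.raisesDegree_extAtiyah nabla0 nabla1)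
      (E'.raisesDegree_extAtiyah nabla0' nabla1') (Connection.raisesDegree_wedgeDefect _ _ _) j
    -- As b commutes with the differentials, Z D b = (Z b) D'. For even j + 1 the terms with Z
    -- become the anticommutator of Z b and D', of supertrace zero, and F' Y b gives a boundary
    -- because Y b has odd degree j.
    have h4 : ((A' ^ (j + 1)) ∘ₗ a - a ∘ₗ (A ^ (j + 1))) ∘ₗ b = (Z ∘ₗ b : Module.End Q _) * E'.extD k +
        (E'.extD k * (Z ∘ₗ b : Module.End Q _) + mulD k _ f * (Y ∘ₗ b : Module.End Q _)) := by
      rw [e, hj.neg_one_pow, one_smul, LinearMap.add_comp, LinearMap.add_comp,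
        LinearMap.comp_assoc, hDb, add_assoc]
      rfl
    rw [h4, mul_add, mul_add, map_add, map_add, formTrace_extParity_mul_extD_mul,
      add_neg_cancel_left, formTrace_extParity_mul_mulD_mul]
    refine mul_dForm_mem_boundaries n (by simpa [Nat.even_add_one] using hj) (formTrace_mem ?_)
    have := (raisesDegree_lTensor (k := k) E'.parity).comp
      (hY.comp (raisesDegree_lTensor β.total))
    rwa [zero_add, add_zero] at this

theorem Homotopic.total {α : Hom E E} (H : Homotopic α (Hom.id E)) :
    ∃ h, E.totalD ∘ₗ h + h ∘ₗ E.totalD = α.total - LinearMap.id := by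
  obtain ⟨h0, h1, e0, e1⟩ := H
  refine ⟨LinearMap.prod (h1 ∘ₗ LinearMap.snd Q E.M0 E.M1) (h0 ∘ₗ LinearMap.fst Q E.M0 E.M1), ?_⟩
  ext x
  · simpa [totalD, Hom.total, Hom.id] using LinearMap.congr_fun e0 x
  · simp [totalD, Hom.total]
  · simp [totalD, Hom.total]
  · simpa [totalD, Hom.total, Hom.id] using LinearMap.congr_fun e1 x

/-- Three comparisons: A'^j with A'^j αβ, A^j with A^j βα, and the two composites with each other.
The connections on both sides are arbitrary, so the identity morphism already yields independence of
the connections. -/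
theorem HomotopyEquivalent.strAtiyah_sub_mem [Algebra ℚ k] (H : HomotopyEquivalent E E')
    (nabla0 : Connection k Q E.M0) (nabla1 : Connection k Q E.M1) (nabla0' : Connection k Q E'.M0)
    (nabla1' : Connection k Q E'.M1) (n j : ℕ) :
    E.strAtiyah nabla0 nabla1 j - E'.strAtiyah nabla0' nabla1' j ∈ boundaries k n f := by
  rcases Nat.even_or_odd j with hj | hj
  · obtain ⟨α, β, h1, h2⟩ := H
    obtain ⟨h, hh⟩ := h1.total
    obtain ⟨h', hh'⟩ := h2.total
    have e1 := formTrace_homotopic_id nabla0' nabla1' n hj hh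
    have e2 := formTrace_homotopic_id nabla0 nabla1 n hj hh'
    have e3 := formTrace_comp_sub_mem α β nabla0 nabla1 nabla0' nabla1' n hj
    convert sub_mem (add_mem e1 (neg_mem e2)) e3 using 1
    abel
  · rw [strAtiyah_odd _ _ _ hj, strAtiyah_odd _ _ _ hj, sub_zero]
    exact zero_mem _

/-- The homology class of the Chern form, which does not depend on the connections. -/
theorem HomotopyEquivalent.mk_chernForm_eq [Algebra ℚ k] (H : HomotopyEquivalent E E')
    (nabla0 : Connection k Q E.M0) (nabla1 : Connection k Q E.M1) (nabla0' : Connection k Q E'.M0)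
    (nabla1' : Connection k Q E'.M1) (n : ℕ) :
    (H0.mk ⟨chernForm n E nabla0 nabla1, E.chernForm_mem_cycles nabla0 nabla1 n⟩ : H0 k n f) =
      H0.mk ⟨chernForm n E' nabla0' nabla1', E'.chernForm_mem_cycles nabla0' nabla1' n⟩ := by
  rw [← sub_eq_zero, ← map_sub]
  refine H0.mk_eq_zero ?_
  change chernForm n E nabla0 nabla1 - chernForm n E' nabla0' nabla1' ∈ _
  rw [chernForm_eq, chernForm_eq, ← Finset.sum_sub_distrib]
  refine sum_mem fun j _ => ?_
  rw [← smul_sub]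
  exact Submodule.smul_mem _ _ (H.strAtiyah_sub_mem nabla0 nabla1 nabla0' nabla1' n j)

end Invariance

/-! ### Horizontal maps intertwine Atiyah operators. -/

section Horizontal

open KaehlerDifferential

variable {k : Type v} {Q : Type u} [CommRing k] [CommRing Q] [Algebra k Q]
  {M N : Type u} [AddCommGroup M] [Module Q M] [AddCommGroup N] [Module Q N] {f : Q}

theorem pow_comp_of_comp {X Y : Type*} [AddCommGroup X] [Module Q X] [AddCommGroup Y] [Module Q Y]
    {A : Module.End Q X} {B : Module.End Q Y} {φ : X →ₗ[Q] Y} (h : B ∘ₗ φ = φ ∘ₗ A) (j : ℕ) :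
    (B ^ j) ∘ₗ φ = φ ∘ₗ (A ^ j) := by
  induction j with
  | zero => rfl
  | succ j ih =>
    rw [pow_succ, pow_succ', Module.End.mul_eq_comp, Module.End.mul_eq_comp, LinearMap.comp_assoc,
      h, ← LinearMap.comp_assoc, ih, LinearMap.comp_assoc, ← Module.End.mul_eq_comp,
      ← Module.End.mul_eq_comp, ← pow_succ, ← pow_succ']

/-- When d'φ = φd is differentiated, the terms with the defect of φ drop out. -/
theorem Connection.IsHorizontal.wedgeDefect_comp_lTensor {nabla : Connection k Q M}
    {nabla' : Connection k Q N} {φ : M →ₗ[Q] N} (hφ : nabla.IsHorizontal nabla' φ)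
    {d : M →ₗ[Q] M} {d' : N →ₗ[Q] N} (h : d' ∘ₗ φ = φ ∘ₗ d) :
    nabla'.wedgeDefect nabla' d' ∘ₗ φ.lTensor (Forms k Q) =
      φ.lTensor (Forms k Q) ∘ₗ nabla.wedgeDefect nabla d := by
  have e := congrArg (nabla.wedgeDefect nabla') h
  rw [wedgeDefect_comp _ nabla', wedgeDefect_comp _ nabla, hφ.wedgeDefect_eq_zero,
    LinearMap.zero_comp, LinearMap.comp_zero, zero_add, add_zero] at e
  exact e

end Horizontal

/-! ### Additivity on cones. -/

section Cone

open KaehlerDifferential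

variable {k : Type v} {Q : Type u} [CommRing k] [CommRing Q] [Algebra k Q] {f : Q}

/-- With these connections i : N → cone α and p : cone α → M[1] are horizontal and compatible with
the differentials, so the Atiyah operator is block triangular and the supertrace is the sum over the
diagonal blocks. The shift reverses the parity, which gives the minus sign of M; it also negates d,
which has no effect for even j. -/
theorem strAtiyah_cone_of_even {M N : MatrixFactorization Q f} (α : Hom M N)
    (m0 : Connection k Q M.M0) (m1 : Connection k Q M.M1) (n0 : Connection k Q N.M0)
    (n1 : Connection k Q N.M1) {j : ℕ} (hj : Even j) :
    M.strAtiyah m0 m1 j + (cone α).strAtiyah (n0.prod m1) (n1.prod m0) j =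
      N.strAtiyah n0 n1 j := by
  let i := (coneIncl α).total
  -- `r` and `s` split `i` and `p` as linear maps only; compatibility with the differentials is not
  -- required of them.
  let r : (cone α).M0 × (cone α).M1 →ₗ[Q] N.M0 × N.M1 :=
    LinearMap.prodMap (LinearMap.fst Q N.M0 M.M1) (LinearMap.fst Q N.M1 M.M0)
  let p : (cone α).M0 × (cone α).M1 →ₗ[Q] M.M0 × M.M1 :=
    LinearMap.prod (LinearMap.snd Q N.M1 M.M0 ∘ₗ LinearMap.snd Q _ _)
      (LinearMap.snd Q N.M0 M.M1 ∘ₗ LinearMap.fst Q _ _)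
  let s : M.M0 × M.M1 →ₗ[Q] (cone α).M0 × (cone α).M1 :=
    LinearMap.prod (LinearMap.inr Q N.M0 M.M1 ∘ₗ LinearMap.snd Q _ _)
      (LinearMap.inr Q N.M1 M.M0 ∘ₗ LinearMap.fst Q _ _)
  have hri : r ∘ₗ i = LinearMap.id := by ext <;> simp [r, i, Hom.total, coneIncl]
  have hps : p ∘ₗ s = LinearMap.id := by ext <;> simp [p, s]
  have hir : i ∘ₗ r + s ∘ₗ p = LinearMap.id := by
    ext <;> simp [r, i, p, s, Hom.total, coneIncl]
  have hpp : p ∘ₗ (cone α).parity = -(M.parity ∘ₗ p) := by ext <;> simp [p, parity]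
  have hpd : M.totalD ∘ₗ p = p ∘ₗ (-(cone α).totalD) := by ext <;> simp [p, totalD]
  have hor_i : (n0.prod n1).IsHorizontal ((n0.prod m1).prod (n1.prod m0)) i :=
    ((Connection.isHorizontal_inl n0 m1).comp (Connection.isHorizontal_fst n0 n1)).prod
      ((Connection.isHorizontal_inl n1 m0).comp (Connection.isHorizontal_snd n0 n1))
  have hor_p : ((n0.prod m1).prod (n1.prod m0)).IsHorizontal (m0.prod m1) p :=
    ((Connection.isHorizontal_snd n1 m0).comp (Connection.isHorizontal_snd _ _)).prod
      ((Connection.isHorizontal_snd n0 m1).comp (Connection.isHorizontal_fst _ _))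
  let A := (cone α).extAtiyah (n0.prod m1) (n1.prod m0)
  let G := (cone α).extParity k
  have hAi : (A ^ j) ∘ₗ i.lTensor (Forms k Q) = i.lTensor (Forms k Q) ∘ₗ N.extAtiyah n0 n1 ^ j :=
    pow_comp_of_comp (hor_i.wedgeDefect_comp_lTensor (coneIncl α).totalD_comp_total) j
  have hAp : p.lTensor (Forms k Q) ∘ₗ (A ^ j) =
      (M.extAtiyah m0 m1 ^ j) ∘ₗ p.lTensor (Forms k Q) := by
    have h := hor_p.wedgeDefect_comp_lTensor hpd
    rw [Connection.wedgeDefect_neg] at h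
    have := pow_comp_of_comp (A := -A) (B := M.extAtiyah m0 m1) h j
    rw [hj.neg_pow] at this
    exact this.symm
  have hGi : G ∘ₗ i.lTensor (Forms k Q) = i.lTensor (Forms k Q) ∘ₗ N.extParity k := by
    simp only [G, extParity, ← LinearMap.lTensor_comp]
    rw [← (coneIncl α).parity_comp_total]
  have hGp : p.lTensor (Forms k Q) ∘ₗ G = -(M.extParity k ∘ₗ p.lTensor (Forms k Q)) := by
    simp only [G, extParity, ← LinearMap.lTensor_comp]
    rw [hpp, LinearMap.lTensor_neg]
  have e1 : formTrace (((G * A ^ j) ∘ₗ i.lTensor (Forms k Q)) ∘ₗ r.lTensor (Forms k Q)) =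
      N.strAtiyah n0 n1 j := by
    rw [← formTrace_comp_comm, Module.End.mul_eq_comp, LinearMap.comp_assoc, hAi,
      ← LinearMap.comp_assoc _ _ G, hGi, LinearMap.comp_assoc, ← LinearMap.comp_assoc,
      ← LinearMap.lTensor_comp, hri, LinearMap.lTensor_id,
      LinearMap.id_comp]
    rfl
  have e2 : formTrace (((G * A ^ j) ∘ₗ s.lTensor (Forms k Q)) ∘ₗ p.lTensor (Forms k Q)) =
      -M.strAtiyah m0 m1 j := by
    rw [← formTrace_comp_comm, Module.End.mul_eq_comp, ← LinearMap.comp_assoc,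
      ← LinearMap.comp_assoc, hGp, LinearMap.neg_comp, LinearMap.comp_assoc _ _ (M.extParity k),
      hAp, LinearMap.neg_comp, LinearMap.comp_assoc, LinearMap.comp_assoc, ← LinearMap.lTensor_comp,
      hps, LinearMap.lTensor_id, LinearMap.comp_id, map_neg]
    rfl
  have e3 : G * A ^ j = ((G * A ^ j) ∘ₗ i.lTensor (Forms k Q)) ∘ₗ r.lTensor (Forms k Q) +
      ((G * A ^ j) ∘ₗ s.lTensor (Forms k Q)) ∘ₗ p.lTensor (Forms k Q) := by
    rw [LinearMap.comp_assoc, LinearMap.comp_assoc, ← LinearMap.lTensor_comp,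
      ← LinearMap.lTensor_comp, ← LinearMap.comp_add, ← LinearMap.lTensor_add, hir,
      LinearMap.lTensor_id, LinearMap.comp_id]
  have e4 : (cone α).strAtiyah (n0.prod m1) (n1.prod m0) j = formTrace (G * A ^ j) := rfl
  rw [e4, e3, map_add, e1, e2]
  abel

theorem chernForm_cone [Algebra ℚ k] {M N : MatrixFactorization Q f} (α : Hom M N)
    (m0 : Connection k Q M.M0) (m1 : Connection k Q M.M1) (n0 : Connection k Q N.M0)
    (n1 : Connection k Q N.M1) (n : ℕ) :
    chernForm n M m0 m1 + chernForm n (cone α) (n0.prod m1) (n1.prod m0) =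
      chernForm n N n0 n1 := by
  rw [chernForm_eq, chernForm_eq, chernForm_eq, ← Finset.sum_add_distrib]
  refine Finset.sum_congr rfl fun j _ => ?_
  rw [← smul_add]
  rcases Nat.even_or_odd j with hj | hj
  · rw [strAtiyah_cone_of_even α m0 m1 n0 n1 hj]
  · rw [strAtiyah_odd _ _ _ hj, strAtiyah_odd _ _ _ hj, strAtiyah_odd _ _ _ hj, add_zero]

end Cone

/-! ### The Chern form of the unit. -/

section Unit

open KaehlerDifferential

variable {k : Type v} {Q : Type u} [CommRing k] [CommRing Q] [Algebra k Q] [Algebra ℚ k] {f : Q}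

/-- The differential is zero, hence At = 0 for any connections, and only the supertrace of the
identity of Q survives. -/
theorem chernForm_unit (e : f = 0) (nabla0 : Connection k Q (unit Q e).M0)
    (nabla1 : Connection k Q (unit Q e).M1) (n : ℕ) :
    chernForm n (unit Q e) nabla0 nabla1 = 1 := by
  have hd : (unit Q e).totalD = 0 := by ext <;> simp [totalD]
  have hA : (unit Q e).extAtiyah nabla0 nabla1 = 0 := by
    rw [extAtiyah_eq]
    refine Connection.IsHorizontal.wedgeDefect_eq_zero ?_
    rw [hd, Connection.isHorizontal_iff]
    simp
  rw [chernForm_eq, Finset.sum_eq_single_of_mem 0 (by simp)]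
  · simp only [Nat.factorial_zero, Nat.cast_one, div_one, map_one, one_smul]
    rw [← supertrace_atiyahPow, supertrace]
    have h0 : (LinearMap.fst Q (unit Q e).M0 (unit Q e).M1).lTensor (Forms k Q) ∘ₗ
        (unit Q e).atiyahPow nabla0 nabla1 0 ∘ₗ LinearMap.inl Q (unit Q e).M0 (unit Q e).M1 =
        dualTensorHom Q Q (Forms k Q ⊗[Q] Q) (LinearMap.id ⊗ₜ (1 ⊗ₜ 1)) := by
      ext
      simp [atiyahPow]
    have h1 : (LinearMap.snd Q (unit Q e).M0 (unit Q e).M1).lTensor (Forms k Q) ∘ₗ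
        (unit Q e).atiyahPow nabla0 nabla1 0 ∘ₗ LinearMap.inr Q (unit Q e).M0 (unit Q e).M1 = 0 := by
      refine LinearMap.ext fun x => ?_
      rw [show x = 0 from Subsingleton.elim (α := PUnit) _ _, map_zero, map_zero]
    rw [h0, h1, traceWith_dualTensorHom]
    simp
  · intro j _ hj
    rw [strAtiyah, hA, zero_pow hj, mul_zero, map_zero, smul_zero]

end Unit

/-! ### Form-valued operators on a tensor product of modules. -/

section TensorTrace

open KaehlerDifferential

variable {k : Type v} {Q : Type u} [CommRing k] [CommRing Q] [Algebra k Q]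
  {M N : Type u} [AddCommGroup M] [Module Q M] [AddCommGroup N] [Module Q N]

variable (k M N) in
/-- The multiplication `(ζ ⊗ x) ⊗ (η ⊗ y) ↦ (η ∧ ζ) ⊗ (x ⊗ y)`. -/
noncomputable def mulTensor :
    (Forms k Q ⊗[Q] M) ⊗[Q] (Forms k Q ⊗[Q] N) →ₗ[Q] Forms k Q ⊗[Q] (M ⊗[Q] N) :=
  -- The second form is put first: operators append their forms on the right, and in `extLeft N S *
  -- extRight M T` the operator T acts first.
  (LinearMap.mul' Q (Forms k Q) ∘ₗ
    (TensorProduct.comm Q (Forms k Q) (Forms k Q)).toLinearMap).rTensor (M ⊗[Q] N) ∘ₗ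
  (TensorProduct.tensorTensorTensorComm Q (Forms k Q) M (Forms k Q) N).toLinearMap

@[simp] theorem mulTensor_tmul (ζ η : Forms k Q) (x : M) (y : N) :
    mulTensor k M N ((ζ ⊗ₜ x) ⊗ₜ (η ⊗ₜ y)) = (η * ζ) ⊗ₜ (x ⊗ₜ y) := by
  simp [mulTensor]

/-- The endomorphisms of `Ω^• ⊗ M` that commute with left multiplication by forms. -/
def IsLeftLinear (S : Module.End Q (Forms k Q ⊗[Q] M)) : Prop :=
  ∀ (η : Forms k Q) (z : Forms k Q ⊗[Q] M),
    S ((LinearMap.mulLeft Q η).rTensor M z) = (LinearMap.mulLeft Q η).rTensor M (S z)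

theorem isLeftLinear_wedge (T : M →ₗ[Q] Ω[Q⁄k] ⊗[Q] M) : IsLeftLinear (wedge T) := by
  intro η z
  induction z with
  | zero => simp
  | add a b ha hb => simp only [map_add, ha, hb]
  | tmul ω x =>
    rw [LinearMap.rTensor_tmul, wedge_tmul, wedge_tmul, LinearMap.mulLeft_apply,
      LinearMap.mulLeft_mul, LinearMap.comp_assoc, LinearMap.rTensor_comp]
    rfl

theorem isLeftLinear_lTensor (φ : M →ₗ[Q] M) : IsLeftLinear (φ.lTensor (Forms k Q)) := by
  intro η z
  induction z with
  | zero => simp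
  | add a b ha hb => simp only [map_add, ha, hb]
  | tmul ω x => simp

theorem IsLeftLinear.mul {S T : Module.End Q (Forms k Q ⊗[Q] M)} (hS : IsLeftLinear S)
    (hT : IsLeftLinear T) : IsLeftLinear (S * T) := fun η z => by
  rw [Module.End.mul_apply, hT, hS, Module.End.mul_apply]

theorem IsLeftLinear.pow {S : Module.End Q (Forms k Q ⊗[Q] M)} (hS : IsLeftLinear S) (j : ℕ) :
    IsLeftLinear (S ^ j) := by
  induction j with
  | zero => exact fun η z => rfl
  | succ j ih => rw [pow_succ]; exact ih.mul hS

theorem traceWith_mulTensor [Module.Finite Q M] [Module.Projective Q M] [Module.Finite Q N]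
    [Module.Projective Q N] (S : M →ₗ[Q] Forms k Q ⊗[Q] M) (T : N →ₗ[Q] Forms k Q ⊗[Q] N) :
    traceWith Q (M ⊗[Q] N) (Forms k Q) (mulTensor k M N ∘ₗ TensorProduct.map S T) =
      traceWith Q N (Forms k Q) T * traceWith Q M (Forms k Q) S := by
  induction S using hom_induction with
  | zero => simp
  | add S S' hS hS' =>
    rw [TensorProduct.map_add_left, LinearMap.comp_add, map_add, map_add, hS, hS', mul_add]
  | tmul φ z =>
    induction T using hom_induction with
    | zero => simp
    | add T T' hT hT' =>
      rw [TensorProduct.map_add_right, LinearMap.comp_add, map_add, map_add, hT, hT', add_mul]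
    | tmul ψ w =>
      have h : mulTensor k M N ∘ₗ TensorProduct.map (dualTensorHom Q M _ (φ ⊗ₜ z))
          (dualTensorHom Q N _ (ψ ⊗ₜ w)) = dualTensorHom Q (M ⊗[Q] N) _
            ((LinearMap.mul' Q Q ∘ₗ TensorProduct.map φ ψ) ⊗ₜ mulTensor k M N (z ⊗ₜ w)) := by
        refine TensorProduct.ext' fun x y => ?_
        simp only [LinearMap.comp_apply, TensorProduct.map_tmul, dualTensorHom_apply,
          LinearMap.mul'_apply, TensorProduct.tmul_smul, map_smul]
        rw [← TensorProduct.smul_tmul', map_smul, smul_smul, mul_comm]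
      rw [h, traceWith_dualTensorHom, traceWith_dualTensorHom, traceWith_dualTensorHom]
      clear h
      induction z with
      | zero => simp
      | add a b ha hb => simp only [TensorProduct.add_tmul, map_add, ha, hb, mul_add]
      | tmul ζ x =>
        induction w with
        | zero => simp
        | add a b ha hb => simp only [TensorProduct.tmul_add, map_add, ha, hb, add_mul]
        | tmul η y => simp [smul_smul]

variable (N) in
/-- The endomorphism `S ⊗ 1` of `Ω^• ⊗ (M ⊗ N)`. -/
noncomputable def extLeft (S : Module.End Q (Forms k Q ⊗[Q] M)) :
    Module.End Q (Forms k Q ⊗[Q] (M ⊗[Q] N)) :=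
  (TensorProduct.assoc Q (Forms k Q) M N).toLinearMap ∘ₗ S.rTensor N ∘ₗ
    (TensorProduct.assoc Q (Forms k Q) M N).symm.toLinearMap

variable (M) in
/-- The endomorphism `1 ⊗ T` of `Ω^• ⊗ (M ⊗ N)`. -/
noncomputable def extRight (T : Module.End Q (Forms k Q ⊗[Q] N)) :
    Module.End Q (Forms k Q ⊗[Q] (M ⊗[Q] N)) :=
  (TensorProduct.leftComm Q M (Forms k Q) N).toLinearMap ∘ₗ T.lTensor M ∘ₗ
    (TensorProduct.leftComm Q M (Forms k Q) N).symm.toLinearMap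

theorem extLeft_tmul (S : Module.End Q (Forms k Q ⊗[Q] M)) (ω : Forms k Q) (x : M) (y : N) :
    extLeft N S (ω ⊗ₜ (x ⊗ₜ y)) = TensorProduct.assoc Q (Forms k Q) M N (S (ω ⊗ₜ x) ⊗ₜ y) := by
  simp [extLeft]

theorem extRight_tmul (T : Module.End Q (Forms k Q ⊗[Q] N)) (ω : Forms k Q) (x : M) (y : N) :
    extRight M T (ω ⊗ₜ (x ⊗ₜ y)) =
      TensorProduct.leftComm Q M (Forms k Q) N (x ⊗ₜ T (ω ⊗ₜ y)) := by
  simp [extRight]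

theorem extLeft_mul (S S' : Module.End Q (Forms k Q ⊗[Q] M)) :
    extLeft N (S * S') = extLeft N S * extLeft N S' := by
  refine TensorProduct.ext_threefold' fun ω x y => ?_
  simp [extLeft]

theorem extRight_mul (S S' : Module.End Q (Forms k Q ⊗[Q] N)) :
    extRight M (S * S') = extRight M S * extRight M S' := by
  refine TensorProduct.ext_threefold' fun ω x y => ?_
  simp [extRight]

theorem extLeft_neg (S : Module.End Q (Forms k Q ⊗[Q] M)) : extLeft N (-S) = -extLeft N S := by
  refine TensorProduct.ext_threefold' fun ω x y => ?_
  simp [extLeft]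

theorem extLeft_one : extLeft N (1 : Module.End Q (Forms k Q ⊗[Q] M)) = 1 := by
  refine TensorProduct.ext_threefold' fun ω x y => ?_
  simp [extLeft]

theorem extRight_one : extRight M (1 : Module.End Q (Forms k Q ⊗[Q] N)) = 1 := by
  refine TensorProduct.ext_threefold' fun ω x y => ?_
  simp [extRight]

theorem extLeft_pow (S : Module.End Q (Forms k Q ⊗[Q] M)) (j : ℕ) :
    extLeft N (S ^ j) = extLeft N S ^ j := by
  induction j with
  | zero => exact extLeft_one
  | succ j ih => rw [pow_succ, extLeft_mul, ih, pow_succ]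

theorem extRight_pow (S : Module.End Q (Forms k Q ⊗[Q] N)) (j : ℕ) :
    extRight M (S ^ j) = extRight M S ^ j := by
  induction j with
  | zero => exact extRight_one
  | succ j ih => rw [pow_succ, extRight_mul, ih, pow_succ]

theorem extLeft_lTensor (φ : M →ₗ[Q] M) :
    extLeft N (φ.lTensor (Forms k Q)) = (φ.rTensor N).lTensor (Forms k Q) := by
  refine TensorProduct.ext_threefold' fun ω x y => ?_
  simp [extLeft]

theorem extRight_lTensor (φ : N →ₗ[Q] N) :
    extRight M (φ.lTensor (Forms k Q)) = (φ.lTensor M).lTensor (Forms k Q) := by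
  refine TensorProduct.ext_threefold' fun ω x y => ?_
  simp [extRight]

/-- By left linearity the form η already present stays on the left, and S need only be evaluated at
1 ⊗ x. -/
theorem extLeft_leftComm {S : Module.End Q (Forms k Q ⊗[Q] M)} (hS : IsLeftLinear S) (x : M)
    (z : Forms k Q ⊗[Q] N) : extLeft N S (TensorProduct.leftComm Q M (Forms k Q) N (x ⊗ₜ z)) =
      mulTensor k M N (S (1 ⊗ₜ x) ⊗ₜ z) := by
  induction z with
  | zero => simp
  | add a b ha hb => simp only [TensorProduct.tmul_add, map_add, ha, hb]
  | tmul η y =>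
    have : η ⊗ₜ[Q] x = (LinearMap.mulLeft Q η).rTensor M ((1 : Forms k Q) ⊗ₜ x) := by simp
    rw [TensorProduct.leftComm_tmul, extLeft_tmul, this, hS]
    induction S (1 ⊗ₜ x) with
    | zero => simp
    | add a b ha hb => simp only [TensorProduct.add_tmul, map_add, ha, hb]
    | tmul ζ x' => simp

theorem formTrace_extLeft_mul_extRight [Module.Finite Q M] [Module.Projective Q M]
    [Module.Finite Q N] [Module.Projective Q N] {S : Module.End Q (Forms k Q ⊗[Q] M)}
    (hS : IsLeftLinear S) (T : Module.End Q (Forms k Q ⊗[Q] N)) :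
    formTrace (extLeft N S * extRight M T) = formTrace T * formTrace S := by
  rw [formTrace_apply, formTrace_apply, formTrace_apply, ← traceWith_mulTensor]
  congr 1
  refine TensorProduct.ext' fun x y => ?_
  simp only [LinearMap.comp_apply, Module.End.mul_apply, TensorProduct.mk_apply, extRight_tmul,
    extLeft_leftComm hS, TensorProduct.map_tmul]

/-- The extensions of `Ω^1`-valued endomorphisms of the two factors anticommute. -/
theorem extLeft_wedge_mul_extRight_wedge (U : M →ₗ[Q] Ω[Q⁄k] ⊗[Q] M)
    (V : N →ₗ[Q] Ω[Q⁄k] ⊗[Q] N) : extLeft N (wedge U) * extRight M (wedge V) =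
      -(extRight M (wedge V) * extLeft N (wedge U)) := by
  refine TensorProduct.ext_threefold' fun ω x y => ?_
  rw [LinearMap.neg_apply, Module.End.mul_apply, Module.End.mul_apply, extRight_tmul,
    extLeft_leftComm (isLeftLinear_wedge U), extLeft_tmul, wedge_tmul, wedge_tmul, wedge_tmul,
    LinearMap.mulLeft_one, LinearMap.id_comp]
  induction U x with
  | zero => simp
  | add a b ha hb => simp only [TensorProduct.add_tmul, map_add, ha, hb, neg_add]
  | tmul v x' =>
    rw [LinearMap.rTensor_tmul, LinearMap.rTensor_tmul, TensorProduct.assoc_tmul, extRight_tmul,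
      wedge_tmul]
    induction V y with
    | zero => simp
    | add a b ha hb => simp only [TensorProduct.tmul_add, map_add, ha, hb, neg_add]
    | tmul v' y' =>
      have := ExteriorAlgebra.ι_add_mul_swap (R := Q) v' v
      simp [mul_assoc, eq_neg_of_add_eq_zero_left this, TensorProduct.neg_tmul]

namespace Connection

theorem wedgeDefect_rTensor_eq (nabla : Connection k Q M) (nabla' : Connection k Q N)
    (φ : M →ₗ[Q] M) : (nabla.tensor nabla').wedgeDefect (nabla.tensor nabla') (φ.rTensor N) =
      extLeft N (nabla.wedgeDefect nabla φ) := by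
  rw [extLeft, ← LinearMap.comp_assoc, ← wedgeDefect_rTensor, LinearMap.comp_assoc,
    LinearEquiv.comp_coe, LinearEquiv.symm_trans_self]
  rfl

theorem wedgeDefect_lTensor_eq (nabla : Connection k Q M) (nabla' : Connection k Q N)
    (φ : N →ₗ[Q] N) : (nabla.tensor nabla').wedgeDefect (nabla.tensor nabla') (φ.lTensor M) =
      extRight M (nabla'.wedgeDefect nabla' φ) := by
  rw [extRight, ← LinearMap.comp_assoc, ← wedgeDefect_lTensor, LinearMap.comp_assoc,
    LinearEquiv.comp_coe, LinearEquiv.symm_trans_self]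
  rfl

end Connection

theorem commute_extLeft_extRight_lTensor (S : Module.End Q (Forms k Q ⊗[Q] M)) (φ : N →ₗ[Q] N) :
    Commute (extLeft N S) (extRight M (φ.lTensor (Forms k Q))) := by
  refine TensorProduct.ext_threefold' fun ω x y => ?_
  rw [Module.End.mul_apply, Module.End.mul_apply, extRight_tmul, LinearMap.lTensor_tmul,
    TensorProduct.leftComm_tmul, extLeft_tmul, extLeft_tmul]
  induction S (ω ⊗ₜ x) with
  | zero => simp
  | add a b ha hb => simp only [TensorProduct.add_tmul, map_add, ha, hb]
  | tmul ζ x' => simp [extRight_tmul]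

theorem commute_extLeft_lTensor_extRight (φ : M →ₗ[Q] M) (T : Module.End Q (Forms k Q ⊗[Q] N)) :
    Commute (extLeft N (φ.lTensor (Forms k Q))) (extRight M T) := by
  refine TensorProduct.ext_threefold' fun ω x y => ?_
  rw [Module.End.mul_apply, Module.End.mul_apply, extRight_tmul, extLeft_tmul,
    LinearMap.lTensor_tmul, TensorProduct.assoc_tmul, extRight_tmul]
  induction T (ω ⊗ₜ y) with
  | zero => simp
  | add a b ha hb => simp only [TensorProduct.tmul_add, map_add, ha, hb]
  | tmul ζ y' => simp [extLeft_tmul]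

/-- The powers of `U ⊗ 1 + γ ⊗ V`, where `γ` anticommutes with the `Ω^1`-valued map `U`. -/
theorem extLeft_add_extRight_pow {U : M →ₗ[Q] Ω[Q⁄k] ⊗[Q] M} {V : N →ₗ[Q] Ω[Q⁄k] ⊗[Q] N}
    {γ : M →ₗ[Q] M} (h : γ.lTensor (Forms k Q) * wedge U = -(wedge U * γ.lTensor (Forms k Q)))
    (j : ℕ) : (extLeft N (wedge U) +
        extRight M (wedge V) * extLeft N (γ.lTensor (Forms k Q))) ^ j =
      ∑ p ∈ Finset.HasAntidiagonal.antidiagonal j, j.choose p.1 • (extLeft N (wedge U ^ p.1 *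
        γ.lTensor (Forms k Q) ^ p.2) * extRight M (wedge V ^ p.2)) := by
  -- The sign from exchanging the one-forms of U and V cancels the sign from moving γ past U, so the
  -- ordinary binomial theorem applies.
  have hc : Commute (extLeft N (wedge U))
      (extRight M (wedge V) * extLeft N (γ.lTensor (Forms k Q))) := by
    have h' := congrArg (extLeft N) h
    rw [extLeft_neg, extLeft_mul, extLeft_mul] at h'
    rw [commute_iff_eq, ← mul_assoc, extLeft_wedge_mul_extRight_wedge, mul_assoc, h', neg_mul,
      mul_neg, mul_assoc]
  rw [hc.add_pow']
  refine Finset.sum_congr rfl fun p _ => ?_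
  have hg := commute_extLeft_lTensor_extRight γ (wedge V)
  rw [hg.symm.mul_pow, extLeft_mul, extLeft_pow, extLeft_pow, extRight_pow, mul_assoc,
    (hg.pow_pow p.2 p.2).eq]

end TensorTrace

/-! ### The Atiyah class of a tensor product of matrix factorizations. -/

section Tensor

open KaehlerDifferential

variable {k : Type v} {Q : Type u} [CommRing k] [CommRing Q] [Algebra k Q] {f g h : Q}

/-- The identification of the tensor product of the total modules with the total module of the
tensor product. -/
noncomputable def tensorTotal (E : MatrixFactorization Q f) (F : MatrixFactorization Q g)
    (e : f + g = h) :
    (E.M0 × E.M1) ⊗[Q] (F.M0 × F.M1) →ₗ[Q] (E.tensor F e).M0 × (E.tensor F e).M1 :=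
  LinearMap.prod
    (LinearMap.prod (TensorProduct.map (LinearMap.fst Q _ _) (LinearMap.fst Q _ _))
      (TensorProduct.map (LinearMap.snd Q _ _) (LinearMap.snd Q _ _)))
    (LinearMap.prod (TensorProduct.map (LinearMap.snd Q _ _) (LinearMap.fst Q _ _))
      (TensorProduct.map (LinearMap.fst Q _ _) (LinearMap.snd Q _ _)))

/-- The inverse of `tensorTotal`. -/
noncomputable def tensorTotalInv (E : MatrixFactorization Q f) (F : MatrixFactorization Q g)
    (e : f + g = h) :
    (E.tensor F e).M0 × (E.tensor F e).M1 →ₗ[Q] (E.M0 × E.M1) ⊗[Q] (F.M0 × F.M1) :=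
  LinearMap.coprod
    (LinearMap.coprod (TensorProduct.map (LinearMap.inl Q _ _) (LinearMap.inl Q _ _))
      (TensorProduct.map (LinearMap.inr Q _ _) (LinearMap.inr Q _ _)))
    (LinearMap.coprod (TensorProduct.map (LinearMap.inr Q _ _) (LinearMap.inl Q _ _))
      (TensorProduct.map (LinearMap.inl Q _ _) (LinearMap.inr Q _ _)))

variable (E : MatrixFactorization Q f) (F : MatrixFactorization Q g) (e : f + g = h)

theorem tensorTotal_comp_tensorTotalInv :
    tensorTotal E F e ∘ₗ tensorTotalInv E F e = LinearMap.id := by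
  ext <;> simp [tensorTotal, tensorTotalInv]

theorem tensorTotalInv_comp_tensorTotal :
    tensorTotalInv E F e ∘ₗ tensorTotal E F e = LinearMap.id := by
  ext <;> simp [tensorTotal, tensorTotalInv]

theorem parity_comp_tensorTotal : (E.tensor F e).parity ∘ₗ tensorTotal E F e =
    tensorTotal E F e ∘ₗ TensorProduct.map E.parity F.parity := by
  ext <;> simp [tensorTotal, parity, TensorProduct.neg_tmul, TensorProduct.tmul_neg]

/-- The Koszul sign (-1)^|x| is carried by the parity of `E`, so the differential becomes a sum of
two operators on an ungraded tensor product. -/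
theorem totalD_comp_tensorTotal : (E.tensor F e).totalD ∘ₗ tensorTotal E F e =
    tensorTotal E F e ∘ₗ (E.totalD.rTensor (F.M0 × F.M1) +
      F.totalD.lTensor (E.M0 × E.M1) ∘ₗ E.parity.rTensor (F.M0 × F.M1)) := by
  ext <;> simp [tensorTotal, parity, totalD, TensorProduct.neg_tmul]

variable (e0 : Connection k Q E.M0) (e1 : Connection k Q E.M1) (f0 : Connection k Q F.M0)
  (f1 : Connection k Q F.M1)

theorem isHorizontal_tensorTotal : ((e0.prod e1).tensor (f0.prod f1)).IsHorizontal
    (((e0.tensor f0).prod (e1.tensor f1)).prod ((e1.tensor f0).prod (e0.tensor f1)))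
    (tensorTotal E F e) :=
  (((Connection.isHorizontal_fst e0 e1).map (Connection.isHorizontal_fst f0 f1)).prod
    ((Connection.isHorizontal_snd e0 e1).map (Connection.isHorizontal_snd f0 f1))).prod
  (((Connection.isHorizontal_snd e0 e1).map (Connection.isHorizontal_fst f0 f1)).prod
    ((Connection.isHorizontal_fst e0 e1).map (Connection.isHorizontal_snd f0 f1)))

/-- The identification of total modules and Γ ⊗ 1 are horizontal for the tensor product connections,
so only the defects of the two differentials contribute. -/
theorem extAtiyah_tensor_comp : (E.tensor F e).extAtiyah ((e0.tensor f0).prod (e1.tensor f1))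
      ((e1.tensor f0).prod (e0.tensor f1)) ∘ₗ (tensorTotal E F e).lTensor (Forms k Q) =
    (tensorTotal E F e).lTensor (Forms k Q) ∘ₗ (extLeft _ (E.extAtiyah e0 e1) +
      extRight _ (F.extAtiyah f0 f1) * extLeft _ (E.extParity k)) := by
  have hp : ((e0.prod e1).tensor (f0.prod f1)).IsHorizontal ((e0.prod e1).tensor (f0.prod f1))
      (E.parity.rTensor (F.M0 × F.M1)) :=
    (E.isHorizontal_parity e0 e1).map Connection.isHorizontal_id
  have := (isHorizontal_tensorTotal E F e e0 e1 f0 f1).wedgeDefect_comp_lTensor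
    (totalD_comp_tensorTotal E F e)
  rw [Connection.wedgeDefect_add, Connection.wedgeDefect_comp _ ((e0.prod e1).tensor (f0.prod f1)),
    hp.wedgeDefect_eq_zero, LinearMap.comp_zero, add_zero, Connection.wedgeDefect_rTensor_eq,
    Connection.wedgeDefect_lTensor_eq, ← extLeft_lTensor] at this
  exact this

theorem strAtiyah_tensor [Algebra ℚ k] (j : ℕ) :
    (E.tensor F e).strAtiyah ((e0.tensor f0).prod (e1.tensor f1))
      ((e1.tensor f0).prod (e0.tensor f1)) j =
    ∑ p ∈ Finset.HasAntidiagonal.antidiagonal j, j.choose p.1 •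
      (F.strAtiyah f0 f1 p.2 * E.strAtiyah e0 e1 p.1) := by
  set A := (E.tensor F e).extAtiyah ((e0.tensor f0).prod (e1.tensor f1))
      ((e1.tensor f0).prod (e0.tensor f1)) with hA
  set B := extLeft (F.M0 × F.M1) (E.extAtiyah e0 e1) +
      extRight (E.M0 × E.M1) (F.extAtiyah f0 f1) * extLeft _ (E.extParity k) with hB
  have h1 : (A ^ j) ∘ₗ (tensorTotal E F e).lTensor (Forms k Q) =
      (tensorTotal E F e).lTensor (Forms k Q) ∘ₗ (B ^ j) :=
    pow_comp_of_comp (extAtiyah_tensor_comp E F e e0 e1 f0 f1) j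
  have h2 : (E.tensor F e).extParity k ∘ₗ (tensorTotal E F e).lTensor (Forms k Q) =
      (tensorTotal E F e).lTensor (Forms k Q) ∘ₗ
        (extLeft _ (E.extParity k) * extRight _ (F.extParity k)) := by
    rw [extParity, extParity, extParity, extLeft_lTensor, extRight_lTensor,
      Module.End.mul_eq_comp, ← LinearMap.lTensor_comp, ← LinearMap.lTensor_comp,
      ← LinearMap.lTensor_comp, LinearMap.rTensor_comp_lTensor, parity_comp_tensorTotal]
  have h3 : (E.tensor F e).extParity k * A ^ j =
      ((tensorTotal E F e).lTensor (Forms k Q) ∘ₗ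
        ((extLeft _ (E.extParity k) * extRight _ (F.extParity k)) * B ^ j)) ∘ₗ
        (tensorTotalInv E F e).lTensor (Forms k Q) := by
    have : (LinearMap.id : Module.End Q (Forms k Q ⊗[Q] ((E.tensor F e).M0 × (E.tensor F e).M1))) =
        (tensorTotal E F e).lTensor (Forms k Q) ∘ₗ
          (tensorTotalInv E F e).lTensor (Forms k Q) := by
      rw [← LinearMap.lTensor_comp, tensorTotal_comp_tensorTotalInv, LinearMap.lTensor_id]
    rw [← LinearMap.comp_id (_ * A ^ j), this, Module.End.mul_eq_comp, LinearMap.comp_assoc,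
      ← LinearMap.comp_assoc _ _ (A ^ j), h1, LinearMap.comp_assoc, ← LinearMap.comp_assoc, h2]
    rfl
  have h4 : formTrace ((E.tensor F e).extParity k * A ^ j) =
      formTrace ((extLeft _ (E.extParity k) * extRight _ (F.extParity k)) * B ^ j) := by
    rw [h3, ← formTrace_comp_comm, ← LinearMap.comp_assoc, ← LinearMap.lTensor_comp,
      tensorTotalInv_comp_tensorTotal, LinearMap.lTensor_id, LinearMap.id_comp]
  have h5 : B ^ j = _ := extLeft_add_extRight_pow (E.extParity_mul_extAtiyah e0 e1) j
  rw [strAtiyah, ← hA, h4, h5, Finset.mul_sum, map_sum]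
  refine Finset.sum_congr rfl fun p _ => ?_
  rw [mul_smul_comm, map_nsmul]
  congr 1
  have h6 : Commute (extLeft _ (E.extAtiyah e0 e1 ^ p.1 * E.extParity k ^ p.2))
      (extRight _ (F.extParity k)) := commute_extLeft_extRight_lTensor _ F.parity
  have h7 : extLeft _ (E.extParity k) * extRight _ (F.extParity k) *
      (extLeft _ (E.extAtiyah e0 e1 ^ p.1 * E.extParity k ^ p.2) *
        extRight _ (F.extAtiyah f0 f1 ^ p.2)) =
      extLeft _ (E.extParity k * (E.extAtiyah e0 e1 ^ p.1 * E.extParity k ^ p.2)) *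
        extRight _ (F.extParity k * F.extAtiyah f0 f1 ^ p.2) := by
    rw [extLeft_mul _ (_ * _), extRight_mul, mul_assoc, mul_assoc,
      ← mul_assoc (extRight _ (F.extParity k)), ← h6.eq, mul_assoc]
  have h8 : formTrace (extLeft (F.M0 × F.M1)
      (E.extParity k * (E.extAtiyah e0 e1 ^ p.1 * E.extParity k ^ p.2)) *
        extRight (E.M0 × E.M1) (F.extParity k * F.extAtiyah f0 f1 ^ p.2)) = _ :=
    formTrace_extLeft_mul_extRight ((isLeftLinear_lTensor _).mul
      (((isLeftLinear_wedge _).pow _).mul ((isLeftLinear_lTensor _).pow _))) _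
  refine (congrArg formTrace h7).trans (h8.trans ?_)
  change F.strAtiyah f0 f1 p.2 * formTrace
    (E.extParity k * (E.extAtiyah e0 e1 ^ p.1 * E.extParity k ^ p.2)) = _
  -- The power of Γ left over from the binomial expansion is harmless: it is 1 for an even exponent,
  -- and for an odd one the supertrace of the factor from `F` vanishes.
  rcases Nat.even_or_odd p.2 with hp | hp
  · obtain ⟨m, hm⟩ := hp
    have : E.extParity k ^ p.2 = 1 := by
      rw [hm, ← two_mul, pow_mul, sq, extParity_mul_self, one_pow]
    rw [this, mul_one]
    rfl
  · rw [strAtiyah_odd _ _ _ hp, zero_mul, zero_mul]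

end Tensor

/-! ### The Chern character on K_0 and on K_f(Q). -/

section ChernCharacter

open KaehlerDifferential

variable {k : Type v} {Q : Type u} [CommRing k] [CommRing Q] [Algebra k Q] [Algebra ℚ k]
  {f g h : Q}

variable (k Q) in
/-- The image of `1 / j!` in `Q`. -/
noncomputable def invFactorial (j : ℕ) : Q :=
  algebraMap k Q (algebraMap ℚ k (1 / (j.factorial : ℚ)))

/-- This absorbs the binomial coefficients of `strAtiyah_tensor` and makes the Chern form multiply
like a truncated exponential. -/
theorem invFactorial_mul_choose {i j m : ℕ} (e : i + m = j) :
    invFactorial k Q j * (j.choose i : Q) = invFactorial k Q i * invFactorial k Q m := by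
  subst e
  simp only [invFactorial]
  rw [← map_natCast (algebraMap k Q), ← map_natCast (algebraMap ℚ k), ← map_mul, ← map_mul,
    ← map_mul, ← map_mul]
  congr 2
  have h1 := Nat.add_choose_mul_factorial_mul_factorial i m
  have h2 : ((i + m).choose i * i.factorial * m.factorial : ℚ) = (i + m).factorial := by
    rw [Nat.choose_symm_add]
    exact_mod_cast h1
  have := Nat.cast_ne_zero (R := ℚ) |>.2 i.factorial_ne_zero
  have := Nat.cast_ne_zero (R := ℚ) |>.2 m.factorial_ne_zero
  have := Nat.cast_ne_zero (R := ℚ) |>.2 (i + m).factorial_ne_zero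
  field_simp
  linear_combination h2

/-- The product of two truncated sums, up to the terms beyond the truncation. -/
theorem sum_mul_sum_sub_mem {R : Type*} [Ring R] (S : AddSubgroup R) (a b : ℕ → R) (n : ℕ)
    (hS : ∀ i m, n < i + m → a i * b m ∈ S) :
    (∑ i ∈ Finset.range (n + 1), a i) * (∑ m ∈ Finset.range (n + 1), b m) -
      ∑ j ∈ Finset.range (n + 1), ∑ p ∈ Finset.HasAntidiagonal.antidiagonal j, a p.1 * b p.2 ∈
        S := by
  -- The antidiagonals up to n fill the pairs of the square with sum at most n; the difference is
  -- therefore the sum over the remaining pairs.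
  have h1 : ∑ j ∈ Finset.range (n + 1), ∑ p ∈ Finset.HasAntidiagonal.antidiagonal j,
      a p.1 * b p.2 = ∑ p ∈ (Finset.range (n + 1) ×ˢ Finset.range (n + 1)).filter
        (fun p : ℕ × ℕ => p.1 + p.2 ≤ n),
        a p.1 * b p.2 := by
    rw [← Finset.sum_fiberwise_of_maps_to (t := Finset.range (n + 1)) (g := fun p : ℕ × ℕ => p.1 + p.2)]
    · refine Finset.sum_congr rfl fun j hj => Finset.sum_congr ?_ fun _ _ => rfl
      ext p
      simp only [Finset.HasAntidiagonal.mem_antidiagonal, Finset.mem_filter, Finset.mem_product,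
        Finset.mem_range] at hj ⊢
      omega
    · intro p hp
      simp only [Finset.mem_filter, Finset.mem_range] at hp ⊢
      omega
  rw [Finset.sum_mul_sum, ← Finset.sum_product', h1,
    ← Finset.sum_filter_add_sum_filter_not _ (fun p : ℕ × ℕ => p.1 + p.2 ≤ n),
    add_sub_cancel_left]
  refine sum_mem fun p hp => hS _ _ ?_
  simpa using (Finset.mem_filter.1 hp).2

theorem chernForm_tensor (E : MatrixFactorization Q f) (F : MatrixFactorization Q g)
    (e : f + g = h) (e0 : Connection k Q E.M0) (e1 : Connection k Q E.M1)
    (f0 : Connection k Q F.M0) (f1 : Connection k Q F.M1) (n : ℕ) :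
    chernForm n E e0 e1 * chernForm n F f0 f1 - chernForm n (E.tensor F e)
      ((e0.tensor f0).prod (e1.tensor f1)) ((e1.tensor f0).prod (e0.tensor f1)) ∈
      boundaries k n h := by
  have h1 : chernForm n (E.tensor F e) ((e0.tensor f0).prod (e1.tensor f1))
      ((e1.tensor f0).prod (e0.tensor f1)) =
      ∑ j ∈ Finset.range (n + 1), ∑ p ∈ Finset.HasAntidiagonal.antidiagonal j,
        (invFactorial k Q p.1 • E.strAtiyah e0 e1 p.1) *
          (invFactorial k Q p.2 • F.strAtiyah f0 f1 p.2) := by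
    rw [chernForm_eq]
    refine Finset.sum_congr rfl fun j _ => ?_
    rw [strAtiyah_tensor, Finset.smul_sum]
    refine Finset.sum_congr rfl fun p hp => ?_
    rw [smul_mul_smul_comm, ← invFactorial_mul_choose (Finset.HasAntidiagonal.mem_antidiagonal.1 hp), mul_smul,
      Nat.cast_smul_eq_nsmul, even_mul_comm (E.strAtiyah_mem_even e0 e1 p.1)]
    rfl
  rw [h1, chernForm_eq, chernForm_eq]
  -- The discrepancy consists of even forms of degree > n, which lie in the second summand of
  -- `boundaries`.
  refine Submodule.mem_sup_right (sum_mul_sum_sub_mem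
    (formsIn k Q {i | Even i} ⊓ formsIn k Q {i | n < i}).toAddSubgroup _ _ n fun i m him => ?_)
  refine ⟨formsIn_mul_mem (fun i hi j hj => Even.add hi hj)
    (Submodule.smul_mem _ _ (E.strAtiyah_mem_even e0 e1 i))
    (Submodule.smul_mem _ _ (F.strAtiyah_mem_even f0 f1 m)), ?_⟩
  have h2 (i : ℕ) : ⋀[Q]^i (Ω[Q⁄k]) ≤ formsIn k Q {i} :=
    le_iSup₂_of_le (f := fun j (_ : j ∈ ({i} : Set ℕ)) => ⋀[Q]^j (Ω[Q⁄k])) i rfl le_rfl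
  refine formsIn_mul_mem (S := {i}) (T := {m}) (fun a ha b hb => ?_)
    (Submodule.smul_mem _ _ (h2 i (E.strAtiyah_mem e0 e1 i)))
    (Submodule.smul_mem _ _ (h2 m (F.strAtiyah_mem f0 f1 m)))
  rw [Set.mem_singleton_iff.1 ha, Set.mem_singleton_iff.1 hb]
  exact him

variable (k) in
/-- The homology class of the Chern form. -/
noncomputable def chernClass (n : ℕ) (E : MatrixFactorization Q f) : H0 k n f :=
  H0.mk ⟨chernForm n E (Connection.nonempty_of_projective (k := k) (Q := Q) E.M0).some
    (Connection.nonempty_of_projective (k := k) (Q := Q) E.M1).some, E.chernForm_mem_cycles _ _ n⟩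

/-- Homotopy invariance applied to the identity of `E`, with different connections on its source and
target. -/
theorem chernClass_eq (n : ℕ) (E : MatrixFactorization Q f) (nabla0 : Connection k Q E.M0)
    (nabla1 : Connection k Q E.M1) : chernClass k n E =
      H0.mk ⟨chernForm n E nabla0 nabla1, E.chernForm_mem_cycles nabla0 nabla1 n⟩ :=
  HomotopyEquivalent.mk_chernForm_eq ⟨Hom.id E, isHomotopyEquiv_id E⟩ _ _ _ _ n

theorem chernClass_congr (n : ℕ) {E E' : MatrixFactorization Q f} (H : HomotopyEquivalent E E') :
    chernClass k n E = chernClass k n E' :=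
  H.mk_chernForm_eq _ _ _ _ n

variable (k f) in
/-- The Chern character on `K0`. -/
noncomputable def K0.chern (n : ℕ) : K0 f →+ H0 k n f :=
  K0.lift (chernClass k n) (fun _ _ => chernClass_congr n) fun M N α => by
    obtain ⟨m0⟩ := Connection.nonempty_of_projective (k := k) (Q := Q) M.M0
    obtain ⟨m1⟩ := Connection.nonempty_of_projective (k := k) (Q := Q) M.M1
    obtain ⟨n0⟩ := Connection.nonempty_of_projective (k := k) (Q := Q) N.M0
    obtain ⟨n1⟩ := Connection.nonempty_of_projective (k := k) (Q := Q) N.M1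
    -- Independence of the connections allows direct sums on the cone, for which additivity holds
    -- already for forms.
    rw [chernClass_eq n M m0 m1, chernClass_eq n N n0 n1,
      chernClass_eq n (cone α) (n0.prod m1) (n1.prod m0), ← map_add]
    exact congrArg H0.mk (Subtype.ext (chernForm_cone α m0 m1 n0 n1 n))

theorem K0.chern_of (n : ℕ) (E : MatrixFactorization Q f) :
    K0.chern k f n (K0.of E) = chernClass k n E :=
  K0.lift_of _ _ _ E

theorem chernClass_tensor (n : ℕ) (E : MatrixFactorization Q f) (F : MatrixFactorization Q g)
    (e : f + g = h) :
    chernClass k n (E.tensor F e) = H0.mul e (chernClass k n E) (chernClass k n F) := by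
  obtain ⟨e0⟩ := Connection.nonempty_of_projective (k := k) (Q := Q) E.M0
  obtain ⟨e1⟩ := Connection.nonempty_of_projective (k := k) (Q := Q) E.M1
  obtain ⟨f0⟩ := Connection.nonempty_of_projective (k := k) (Q := Q) F.M0
  obtain ⟨f1⟩ := Connection.nonempty_of_projective (k := k) (Q := Q) F.M1
  rw [chernClass_eq n E e0 e1, chernClass_eq n F f0 f1, chernClass_eq n (E.tensor F e)
    ((e0.tensor f0).prod (e1.tensor f1)) ((e1.tensor f0).prod (e0.tensor f1)), H0.mul_mk, eq_comm,
    ← sub_eq_zero, ← map_sub]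
  exact H0.mk_eq_zero (chernForm_tensor E F e e0 e1 f0 f1 n)

theorem K0.chern_mul (n : ℕ) (e : f + g = h) (x : K0 f) (y : K0 g) :
    K0.chern k h n (K0.mul e x y) = H0.mul e (K0.chern k f n x) (K0.chern k g n y) := by
  induction x using K0.induction with
  | zero => simp
  | neg x hx => simp [hx]
  | add x y hx hy => simp [hx, hy]
  | of E =>
    induction y using K0.induction with
    | zero => simp
    | neg x hx => simp [hx]
    | add x y hx hy => simp [hx, hy]
    | of F =>
      rw [K0.mul_of, K0.chern_of, K0.chern_of, K0.chern_of, chernClass_tensor]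

variable (k f) in
/-- The Chern character as a ring homomorphism. -/
noncomputable def Kf.chern (n : ℕ) : Kf f →+* Hf k n f :=
  DirectSum.toSemiring (fun i => (DirectSum.of (GradedH0 k n f) i).comp (K0.chern k (i • f) n))
    (by
      change DirectSum.of (GradedH0 k n f) 0 (K0.chern k ((0 : ℕ) • f) n (K0.of _)) = _
      refine congrArg (DirectSum.of (GradedH0 k n f) 0) ((K0.chern_of n _).trans ?_)
      exact congrArg H0.mk (Subtype.ext (chernForm_unit (zero_smul ℕ f) _ _ n)))
    (fun {i j} x y => by
      refine Eq.trans ?_ (DirectSum.of_mul_of (A := GradedH0 k n f) _ _).symm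
      exact congrArg (DirectSum.of (GradedH0 k n f) (i + j))
        (K0.chern_mul n (add_smul i j f).symm x y))

theorem Kf.chern_of (n : ℕ) {i : ℕ} (E : MatrixFactorization Q (i • f))
    (nabla0 : Connection k Q E.M0) (nabla1 : Connection k Q E.M1) :
    Kf.chern k f n (Kf.of E) =
      Hf.of (chernForm n E nabla0 nabla1) (E.chernForm_mem_cycles nabla0 nabla1 n) := by
  refine (DirectSum.toAddMonoid_of _ i _).trans ?_
  refine congrArg (DirectSum.of (GradedH0 k n f) i) ?_
  exact (K0.chern_of n E).trans (chernClass_eq n E nabla0 nabla1)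

/-- Each K_0 is generated as a group by classes of objects, and K_f(Q) is the direct sum of these
groups. -/
theorem Kf.ringHom_ext {R : Type*} [Ring R] {φ ψ : Kf f →+* R}
    (H : ∀ (i : ℕ) (E : MatrixFactorization Q (i • f)), φ (Kf.of E) = ψ (Kf.of E)) : φ = ψ := by
  refine DirectSum.ringHom_ext fun i x => ?_
  refine K0.induction (p := fun x => φ (DirectSum.of (GradedK0 f) i x) =
    ψ (DirectSum.of (GradedK0 f) i x)) x (H i) (fun x hx => ?_) (fun x y hx hy => ?_) ?_
  · have h := map_neg (DirectSum.of (GradedK0 f) i) x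
    refine (congrArg φ h).trans (Eq.trans ?_ (congrArg ψ h).symm)
    rw [map_neg, map_neg]
    exact congrArg Neg.neg hx
  · have h := map_add (DirectSum.of (GradedK0 f) i) x y
    refine (congrArg φ h).trans (Eq.trans ?_ (congrArg ψ h).symm)
    rw [map_add, map_add]
    exact congrArg₂ (· + ·) hx hy
  · have h := map_zero (DirectSum.of (GradedK0 f) i)
    refine (congrArg φ h).trans (Eq.trans ?_ (congrArg ψ h).symm)
    rw [map_zero, map_zero]

end ChernCharacter

end MatrixFactorization

open MatrixFactorization in
theorem corollary5p18 {k : Type v} {Q : Type u} [CommRing k] [CommRing Q] [Algebra ℚ k]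
    [Algebra k Q] (n : ℕ) (hQ : IsSmoothOfRelativeDimension k Q n) (f : Q) :
    (∀ (g : Q) (E : MatrixFactorization Q g),
      Nonempty (Connection k Q E.M0) ∧ Nonempty (Connection k Q E.M1)) ∧
    ∃! ch : Kf f →+* Hf k n f,
      (∀ (i : ℕ) (E : MatrixFactorization Q (i • f)) (nabla0 : Connection k Q E.M0)
        (nabla1 : Connection k Q E.M1), ∃ hc : chernForm n E nabla0 nabla1 ∈ cycles k n (i • f),
        ch (Kf.of E) = Hf.of (chernForm n E nabla0 nabla1) hc) ∧
      ∀ (i j : ℕ) (E : MatrixFactorization Q (i • f)) (F : MatrixFactorization Q (j • f)),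
        ch (Kf.of (E.tensor F (add_smul i j f).symm)) = ch (Kf.of E) * ch (Kf.of F) := by
  refine ⟨fun g E => ⟨Connection.nonempty_of_projective E.M0,
    Connection.nonempty_of_projective E.M1⟩, Kf.chern k f n,
    ⟨fun i E nabla0 nabla1 => ⟨E.chernForm_mem_cycles nabla0 nabla1 n,
      Kf.chern_of n E nabla0 nabla1⟩, fun i j E F => ?_⟩, fun ch' h => Kf.ringHom_ext fun i E => ?_⟩
  · rw [← Kf.of_mul_of, map_mul]
  -- The prescribed value for a single choice of connections determines the homomorphism on the
  -- class of `E`.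
  · obtain ⟨nabla0⟩ := Connection.nonempty_of_projective (k := k) (Q := Q) E.M0
    obtain ⟨nabla1⟩ := Connection.nonempty_of_projective (k := k) (Q := Q) E.M1
    obtain ⟨hc, e⟩ := h.1 i E nabla0 nabla1
    rw [e, Kf.chern_of n E nabla0 nabla1]
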